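/- Let $k$ be a field of characteristic $p>2$, let $\mathfrak g=\mathfrak{sl}_2(k)$, and let $U=U(\mathfrak g)$ be its universal enveloping algebra. Regard $k$ as the trivial $U$-module, and for $n\ge 0$ let $S^n=S^n(\mathfrak g)$ be the $n$-th symmetric power of the adjoint $\mathfrak g$-module (the degree $n$ part of the symmetric algebra of $\mathfrak g$, on which $\mathfrak g$ acts by derivations extending the adjoint action), regarded as a $U$-module. Write $n=qp+r$ with integers $q\ge 0$ and $0\le r<p$. Then $\operatorname{Ext}^3_U(k,S^n)$ is a finite-dimensional $k$-vector space and $$\dim_k \operatorname{Ext}^3_U(k,S^n)=\begin{cases}1 & \text{if } n\le p-3 \text{ and } n \text{ is even},\\ \binom{q+2}{2} & \text{if } r=p-1,\\ \binom{q+1}{2} & \text{if } r \text{ is odd},\\ \binom{q}{2} & \text{if } r<p-1 \text{ is even and } n>p-3.\end{cases}$$ -/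

import Mathlib

open CategoryTheory
open scoped ModuleCat

attribute [local instance 100] LieRing.ofAssociativeRing

noncomputable section

namespace SymLie

section General

universe u v

variable (R : Type u) [CommRing R] (L : Type v) [LieRing L] [LieAlgebra R L]

/-- The algebra homomorphism `s ↦ s + ε D(s)` into the dual numbers over the symmetric algebra,
where `D` extends `ad x`. -/
def adDual (x : L) :
    SymmetricAlgebra R L →ₐ[R] TrivSqZeroExt (SymmetricAlgebra R L) (SymmetricAlgebra R L) :=
  SymmetricAlgebra.lift
    ((TrivSqZeroExt.inlAlgHom R (SymmetricAlgebra R L) (SymmetricAlgebra R L)).toLinearMap ∘ₗ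
        SymmetricAlgebra.ι R L +
      (TrivSqZeroExt.inrHom (SymmetricAlgebra R L) (SymmetricAlgebra R L)).restrictScalars R ∘ₗ
        SymmetricAlgebra.ι R L ∘ₗ (LieAlgebra.ad R L x : L →ₗ[R] L))

theorem adDual_ι (x y : L) :
    adDual R L x (SymmetricAlgebra.ι R L y) =
      TrivSqZeroExt.inl (SymmetricAlgebra.ι R L y) +
        TrivSqZeroExt.inr (SymmetricAlgebra.ι R L ⁅x, y⁆) := by
  simp [adDual]

theorem adDual_fst (x : L) (s : SymmetricAlgebra R L) : (adDual R L x s).fst = s := by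
  have h : (TrivSqZeroExt.fstHom R (SymmetricAlgebra R L) (SymmetricAlgebra R L)).comp
      (adDual R L x) = AlgHom.id R _ := by
    apply SymmetricAlgebra.algHom_ext
    ext y
    simp [adDual_ι]
  exact congrArg (fun f => f s) h

/-- The action of `x : L` on the symmetric algebra of the adjoint module: the unique derivation
that extends `ad x : L → L`. -/
def adDer (x : L) : Derivation R (SymmetricAlgebra R L) (SymmetricAlgebra R L) :=
  Derivation.mk'
    ((TrivSqZeroExt.sndHom (SymmetricAlgebra R L) (SymmetricAlgebra R L)).restrictScalars R ∘ₗ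
      (adDual R L x).toLinearMap)
    (fun a b => by simp [adDual_fst, mul_comm])

theorem adDer_ι (x y : L) :
    adDer R L x (SymmetricAlgebra.ι R L y) = SymmetricAlgebra.ι R L ⁅x, y⁆ := by
  simp [adDer, adDual_ι]

theorem adjoin_range_ι :
    Algebra.adjoin R (Set.range (SymmetricAlgebra.ι R L)) = ⊤ := by
  rw [eq_top_iff]
  intro a _
  induction a using SymmetricAlgebra.induction with
  | algebraMap r => exact Subalgebra.algebraMap_mem _ r
  | ι x => exact Algebra.subset_adjoin ⟨x, rfl⟩
  | mul a b ha hb => exact Subalgebra.mul_mem _ (ha trivial) (hb trivial)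
  | add a b ha hb => exact Subalgebra.add_mem _ (ha trivial) (hb trivial)

theorem der_ext {D₁ D₂ : Derivation R (SymmetricAlgebra R L) (SymmetricAlgebra R L)}
    (h : ∀ y, D₁ (SymmetricAlgebra.ι R L y) = D₂ (SymmetricAlgebra.ι R L y)) : D₁ = D₂ := by
  apply Derivation.ext_of_adjoin_eq_top _ (adjoin_range_ι R L)
  rintro _ ⟨y, rfl⟩
  exact h y

/-- The `n`-th symmetric power of `L`: the degree `n` part of the symmetric algebra,
spanned by the products of `n` elements of `L`. -/
def SymPow (n : ℕ) : Submodule R (SymmetricAlgebra R L) :=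
  LinearMap.range (SymmetricAlgebra.ι R L) ^ n

theorem adDer_mem (x : L) (n : ℕ) :
    ∀ s ∈ SymPow R L n, adDer R L x s ∈ SymPow R L n := by
  induction n with
  | zero =>
    intro s hs
    obtain ⟨r, rfl⟩ := Submodule.mem_one.mp (by simpa [SymPow] using hs)
    rw [Derivation.map_algebraMap]
    exact Submodule.zero_mem _
  | succ n ih =>
    intro s hs
    rw [SymPow, pow_succ] at hs
    induction hs using Submodule.mul_induction_on' with
    | mem_mul_mem a ha b hb =>
      obtain ⟨y, rfl⟩ := hb
      rw [Derivation.leibniz, adDer_ι, SymPow, pow_succ]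
      refine Submodule.add_mem _ (Submodule.mul_mem_mul ha ⟨_, rfl⟩) ?_
      rw [smul_eq_mul, mul_comm (SymmetricAlgebra.ι R L y)]
      exact Submodule.mul_mem_mul (ih a ha) ⟨y, rfl⟩
    | add a _ b _ ha hb => rw [map_add]; exact Submodule.add_mem _ ha hb

/-- The representation of `L` on the `n`-th symmetric power of its adjoint module. -/
def symRep (n : ℕ) : L →ₗ⁅R⁆ Module.End R (SymPow R L n) where
  toFun x := (adDer R L x).toLinearMap.restrict (adDer_mem R L x n)
  map_add' x y := by
    have h : adDer R L (x + y) = adDer R L x + adDer R L y :=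
      der_ext R L fun z => by simp [adDer_ι]
    ext s
    simp [h]
  map_smul' r x := by
    have h : adDer R L (r • x) = r • adDer R L x := der_ext R L fun z => by simp [adDer_ι]
    ext s
    simp [h]
  map_lie' {x y} := by
    have h : adDer R L ⁅x, y⁆ = ⁅adDer R L x, adDer R L y⁆ :=
      der_ext R L fun z => by simp [Derivation.commutator_apply, adDer_ι]
    ext s
    simp [h, LieRing.of_associative_ring_bracket]

/-- A representation of `L`, as a left module over the universal enveloping algebra. -/
def envModule {M : Type*} [AddCommGroup M] [Module R M] (ρ : L →ₗ⁅R⁆ Module.End R M) :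
    ModuleCat (UniversalEnvelopingAlgebra R L) :=
  letI : Module (UniversalEnvelopingAlgebra R L) M :=
    Module.compHom M (UniversalEnvelopingAlgebra.lift R ρ).toRingHom
  ModuleCat.of (UniversalEnvelopingAlgebra R L) M

end General

section SL2

universe u

variable (k : Type u) [Field k]

/-- The Lie algebra `𝔰𝔩₂(k)` of traceless `2 × 2` matrices. -/
abbrev sl2 : LieSubalgebra k (Matrix (Fin 2) (Fin 2) k) := LieAlgebra.SpecialLinear.sl (Fin 2) k

/-- The universal enveloping algebra of `𝔰𝔩₂(k)`. -/
abbrev U : Type u := UniversalEnvelopingAlgebra k (sl2 k)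

/-- The trivial one-dimensional `U`-module `k`. -/
def trivialModule : ModuleCat.{u} (U k) := envModule k (sl2 k) (0 : sl2 k →ₗ⁅k⁆ Module.End k k)

/-- The `n`-th symmetric power of the adjoint module of `𝔰𝔩₂(k)`, as a `U`-module. -/
def symModule (n : ℕ) : ModuleCat.{u} (U k) := envModule k (sl2 k) (symRep k (sl2 k) n)

end SL2

end SymLie

end

/-!
The proof has two independent halves.

*Cohomology.* Since `𝔰𝔩₂` is three-dimensional and unimodular, `Ext³_U(k, M)` is the space of
coinvariants `M / (e M + h M + f M)`. This is read off from the Chevalley–Eilenberg resolution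
`0 → U → U³ → U³ → U → k → 0` by dimension shifting (`exists_surjective_ext_three`). Exactness of the
resolution rests on the Poincaré–Birkhoff–Witt theorem for `𝔰𝔩₂`, which is proved by letting `U` act
on the space of normal forms `∑ f ^ a * g(h) * e ^ c`. It is only used through three cancellation
statements: `u e = 0` forces `u = 0`; `u (h + m) ∈ U e` forces `u ∈ U e`; and `u f ∈ U e + U h` forces
`u ∈ U e + U (h + 2)`.

*Coinvariants of `Sⁿ`.* The operators `e`, `h`, `f` send monomials `e ^ a * h ^ b * f ^ c` to
combinations of at most two monomials. In the coinvariants a monomial with `a ≢ c` modulo `p`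
vanishes, and the other ones are arranged in chains `(a + i, b - 2 i, c + i)` along which consecutive
monomials satisfy `2 (b + 1) [a, b, c] = c [a - 1, b + 2, c - 1]`. The chains break exactly where
`p ∣ b + 1`, so the classes of the monomials with `p ∣ b + 1` and `a ≡ c` modulo `p`, together with
`h ^ n` if `n ≤ p - 3` is even, span (`coinvariant_mem_of_sources_mem`). They are independent because
each of them is detected by an invariant functional supported on its part of the chain
(`exists_invariant_functional`). Writing `a = p i + t`, `b + 1 = p j`, `c = p l + t` turns the count of
these monomials into the number of solutions of `i + j + l = K` with `j ≥ 1` (`ncard_triples`).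
-/

noncomputable section

namespace SymLie

/-! ### Dimension shifting along a resolution of length three -/

section DimensionShift

universe u

variable {k : Type u} [Field k] {A : Type u} [Ring A] [Algebra k A]

/-- The connecting map out of `Ext(S.X₁, Y)` is onto when the middle term is projective. -/
theorem extClass_comp_surjective {S : ShortComplex (ModuleCat.{u} A)} (hS : S.ShortExact)
    [Projective S.X₂] (Y : ModuleCat.{u} A) (n : ℕ) :
    Function.Surjective
      (Abelian.Ext.precompOfLinear hS.extClass k Y (Nat.add_comm 1 n)) := by
  intro x
  exact Abelian.Ext.contravariant_sequence_exact₃ hS Y x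
    (Abelian.Ext.eq_zero_of_projective _) (Nat.add_comm 1 n)

theorem extClass_comp_bijective {S : ShortComplex (ModuleCat.{u} A)} (hS : S.ShortExact)
    [Projective S.X₂] (Y : ModuleCat.{u} A) (n : ℕ) :
    Function.Bijective
      (Abelian.Ext.precompOfLinear hS.extClass k Y (Nat.add_comm 1 (n + 1))) := by
  refine ⟨(injective_iff_map_eq_zero _).2 fun x hx => ?_, extClass_comp_surjective hS Y _⟩
  obtain ⟨y, rfl⟩ := Abelian.Ext.contravariant_sequence_exact₁ hS Y x (Nat.add_comm 1 (n + 1)) hx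
  rw [Abelian.Ext.eq_zero_of_projective y, Abelian.Ext.comp_zero]

/-- A projective resolution of length three computes `Ext³` as the cokernel of the last
coboundary. -/
theorem exists_surjective_ext_three {P₀ P₁ P₂ P₃ Q : Type u}
    [AddCommGroup P₀] [Module A P₀] [AddCommGroup P₁] [Module A P₁]
    [AddCommGroup P₂] [Module A P₂] [AddCommGroup P₃] [Module A P₃]
    [AddCommGroup Q] [Module A Q]
    [Module.Projective A P₀] [Module.Projective A P₁] [Module.Projective A P₂]
    (d₃ : P₃ →ₗ[A] P₂) (d₂ : P₂ →ₗ[A] P₁) (d₁ : P₁ →ₗ[A] P₀) (ε : P₀ →ₗ[A] Q)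
    (h₃ : Function.Injective d₃) (h₃₂ : Function.Exact d₃ d₂) (h₂₁ : Function.Exact d₂ d₁)
    (h₁₀ : Function.Exact d₁ ε) (h₀ : Function.Surjective ε) (M : ModuleCat.{u} A) :
    ∃ Φ : (ModuleCat.of A P₃ ⟶ M) →ₗ[k] Abelian.Ext (ModuleCat.of A Q) M 3,
      Function.Surjective Φ ∧
      ∀ f, Φ f = 0 ↔ ∃ g : ModuleCat.of A P₂ ⟶ M, ModuleCat.ofHom d₃ ≫ g = f := by
  -- The resolution is spliced from short exact sequences along the ranges of `d₁` and `d₂`.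
  let S₀ : ShortComplex (ModuleCat.{u} A) := ShortComplex.mk
    (ModuleCat.ofHom (LinearMap.range d₁).subtype) (ModuleCat.ofHom ε) (by
      ext ⟨_, x, rfl⟩; exact h₁₀.apply_apply_eq_zero x)
  let S₁ : ShortComplex (ModuleCat.{u} A) := ShortComplex.mk
    (ModuleCat.ofHom (LinearMap.range d₂).subtype) (ModuleCat.ofHom d₁.rangeRestrict) (by
      ext ⟨_, x, rfl⟩; exact h₂₁.apply_apply_eq_zero x)
  let S₂ : ShortComplex (ModuleCat.{u} A) := ShortComplex.mk
    (ModuleCat.ofHom d₃) (ModuleCat.ofHom d₂.rangeRestrict) (by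
      ext x; exact h₃₂.apply_apply_eq_zero x)
  have hS₀ : S₀.ShortExact := ModuleCat.shortComplex_shortExact _
    (fun x => (h₁₀ x).trans
      ⟨fun ⟨y, hy⟩ => ⟨⟨x, y, hy⟩, rfl⟩, fun ⟨⟨_, y, hy⟩, h⟩ => ⟨y, hy.trans h⟩⟩)
    Subtype.val_injective h₀
  have hS₁ : S₁.ShortExact := ModuleCat.shortComplex_shortExact _
    (fun x => Subtype.ext_iff.trans ((h₂₁ x).trans
      ⟨fun ⟨y, hy⟩ => ⟨⟨x, y, hy⟩, rfl⟩, fun ⟨⟨_, y, hy⟩, h⟩ => ⟨y, hy.trans h⟩⟩))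
    Subtype.val_injective d₁.surjective_rangeRestrict
  have hS₂ : S₂.ShortExact := ModuleCat.shortComplex_shortExact _
    (fun x => Subtype.ext_iff.trans (h₃₂ x)) h₃ d₂.surjective_rangeRestrict
  have : Projective S₀.X₂ := ModuleCat.projective_of_categoryTheory_projective (ModuleCat.of A P₀)
  have : Projective S₁.X₂ := ModuleCat.projective_of_categoryTheory_projective (ModuleCat.of A P₁)
  have : Projective S₂.X₂ := ModuleCat.projective_of_categoryTheory_projective (ModuleCat.of A P₂)
  let δ₂ : Abelian.Ext S₂.X₁ M 0 →ₗ[k] Abelian.Ext S₁.X₁ M 1 :=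
    Abelian.Ext.precompOfLinear hS₂.extClass k M (Nat.add_comm 1 0)
  let δ₁ : Abelian.Ext S₁.X₁ M 1 →ₗ[k] Abelian.Ext S₀.X₁ M 2 :=
    Abelian.Ext.precompOfLinear hS₁.extClass k M (Nat.add_comm 1 1)
  let δ₀ : Abelian.Ext S₀.X₁ M 2 →ₗ[k] Abelian.Ext S₀.X₃ M 3 :=
    Abelian.Ext.precompOfLinear hS₀.extClass k M (Nat.add_comm 1 2)
  have b₁ : Function.Bijective δ₁ := extClass_comp_bijective hS₁ M 0
  have b₀ : Function.Bijective δ₀ := extClass_comp_bijective hS₀ M 1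
  have s₂ : Function.Surjective δ₂ := extClass_comp_surjective hS₂ M 0
  refine ⟨δ₀ ∘ₗ δ₁ ∘ₗ δ₂ ∘ₗ Abelian.Ext.linearEquiv₀.symm.toLinearMap,
    b₀.surjective.comp (b₁.surjective.comp (s₂.comp (LinearEquiv.surjective _))), fun f => ?_⟩
  rw [LinearMap.comp_apply, map_eq_zero_iff _ b₀.injective, LinearMap.comp_apply,
    map_eq_zero_iff _ b₁.injective, LinearMap.comp_apply]
  constructor
  · intro h
    obtain ⟨y, hy⟩ := Abelian.Ext.contravariant_sequence_exact₁ hS₂ M _ (Nat.add_comm 1 0) h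
    refine ⟨Abelian.Ext.homEquiv₀ y, (Abelian.Ext.mk₀_bijective _ _).1 ?_⟩
    rw [← Abelian.Ext.mk₀_comp_mk₀, Abelian.Ext.mk₀_homEquiv₀_apply]
    exact hy
  · rintro ⟨g, rfl⟩
    change hS₂.extClass.comp (Abelian.Ext.mk₀ (S₂.f ≫ g)) (Nat.add_comm 1 0) = 0
    rw [← Abelian.Ext.mk₀_comp_mk₀]
    exact hS₂.extClass_comp_assoc _

end DimensionShift

/-! ### Generators and relations of the enveloping algebra of `𝔰𝔩₂` -/

section Generators

universe u

variable (k : Type u) [Field k]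

/-- The raising element `e` of `𝔰𝔩₂`. -/
def slE : sl2 k := ⟨!![0, 1; 0, 0], by simp [LieAlgebra.SpecialLinear.sl, Matrix.trace]⟩

/-- The diagonal element `h` of `𝔰𝔩₂`. -/
def slH : sl2 k := ⟨!![1, 0; 0, -1], by simp [LieAlgebra.SpecialLinear.sl, Matrix.trace]⟩

/-- The lowering element `f` of `𝔰𝔩₂`. -/
def slF : sl2 k := ⟨!![0, 0; 1, 0], by simp [LieAlgebra.SpecialLinear.sl, Matrix.trace]⟩

theorem sl2_eq (x : sl2 k) : x = x.1 0 1 • slE k + x.1 0 0 • slH k + x.1 1 0 • slF k := by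
  have hx : x.1.trace = 0 := x.2
  rw [Matrix.trace_fin_two] at hx
  apply Subtype.ext
  ext i j
  fin_cases i <;> fin_cases j <;> simp [slE, slH, slF]
  linear_combination hx

theorem lie_slH_slE : ⁅slH k, slE k⁆ = (2 : k) • slE k := by
  apply Subtype.ext
  ext i j
  fin_cases i <;> fin_cases j <;> simp [slE, slH, Ring.lie_def]; ring

theorem lie_slH_slF : ⁅slH k, slF k⁆ = (-2 : k) • slF k := by
  apply Subtype.ext
  ext i j
  fin_cases i <;> fin_cases j <;> simp [slF, slH, Ring.lie_def]; ring

theorem lie_slE_slF : ⁅slE k, slF k⁆ = slH k := by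
  apply Subtype.ext
  ext i j
  fin_cases i <;> fin_cases j <;> simp [slF, slE, slH, Ring.lie_def]

/-- A triple of operators with the commutation relations of `𝔰𝔩₂` defines a representation. -/
def repOfTriple {V : Type*} [AddCommGroup V] [Module k V] (E H F : Module.End k V)
    (hHE : H * E - E * H = (2 : k) • E) (hHF : H * F - F * H = (-2 : k) • F)
    (hEF : E * F - F * E = H) : sl2 k →ₗ⁅k⁆ Module.End k V where
  toFun x := x.1 0 1 • E + x.1 0 0 • H + x.1 1 0 • F
  map_add' x y := by
    change (x.1 0 1 + y.1 0 1) • E + (x.1 0 0 + y.1 0 0) • H + (x.1 1 0 + y.1 1 0) • F = _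
    module
  map_smul' r x := by
    change (r * x.1 0 1) • E + (r * x.1 0 0) • H + (r * x.1 1 0) • F = r • _
    module
  map_lie' {x y} := by
    have hx : x.1.trace = 0 := x.2
    have hy : y.1.trace = 0 := y.2
    rw [Matrix.trace_fin_two, add_comm, add_eq_zero_iff_eq_neg] at hx hy
    change (x.1 * y.1 - y.1 * x.1) 0 1 • E + (x.1 * y.1 - y.1 * x.1) 0 0 • H +
      (x.1 * y.1 - y.1 * x.1) 1 0 • F = _
    simp only [Ring.lie_def, Matrix.sub_apply, Matrix.mul_apply, Fin.sum_univ_two, hx, hy]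
    rw [sub_eq_iff_eq_add] at hHE hHF hEF
    simp only [mul_add, add_mul, smul_mul_smul_comm, hHE, hHF, hEF]
    module

/-- The element `e` of the enveloping algebra. -/
def uE : U k := UniversalEnvelopingAlgebra.ι k (slE k)

/-- The element `h` of the enveloping algebra. -/
def uH : U k := UniversalEnvelopingAlgebra.ι k (slH k)

/-- The element `f` of the enveloping algebra. -/
def uF : U k := UniversalEnvelopingAlgebra.ι k (slF k)

theorem uH_mul_uE : uH k * uE k = uE k * uH k + 2 * uE k := by
  have h := congrArg (UniversalEnvelopingAlgebra.ι k) (lie_slH_slE k)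
  rw [LieHom.map_lie, Ring.lie_def, map_smul, sub_eq_iff_eq_add, ofNat_smul_eq_nsmul,
    nsmul_eq_mul] at h
  rw [uE, uH, h, add_comm]; rfl

theorem uH_mul_uF : uH k * uF k = uF k * uH k - 2 * uF k := by
  have h := congrArg (UniversalEnvelopingAlgebra.ι k) (lie_slH_slF k)
  rw [LieHom.map_lie, Ring.lie_def, map_smul, sub_eq_iff_eq_add, neg_smul, ofNat_smul_eq_nsmul,
    nsmul_eq_mul] at h
  rw [uF, uH, h, neg_add_eq_sub]; rfl

theorem uE_mul_uF : uE k * uF k = uF k * uE k + uH k := by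
  have h := congrArg (UniversalEnvelopingAlgebra.ι k) (lie_slE_slF k)
  rw [LieHom.map_lie, Ring.lie_def, sub_eq_iff_eq_add] at h
  rw [uF, uH, uE, h, add_comm]

variable {k}

theorem subalgebra_eq_top (S : Subalgebra k (U k)) (hE : uE k ∈ S) (hH : uH k ∈ S)
    (hF : uF k ∈ S) : S = ⊤ := by
  have hι : ∀ x, UniversalEnvelopingAlgebra.ι k x ∈ S := fun x => by
    rw [sl2_eq k x, map_add, map_add, map_smul, map_smul, map_smul]
    exact S.add_mem (S.add_mem (S.smul_mem hE _) (S.smul_mem hH _)) (S.smul_mem hF _)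
  let g : sl2 k →ₗ⁅k⁆ S :=
    { toFun x := ⟨UniversalEnvelopingAlgebra.ι k x, hι x⟩
      map_add' x y := Subtype.ext (map_add _ x y)
      map_smul' r x := Subtype.ext (map_smul _ r x)
      map_lie' {x y} := Subtype.ext (LieHom.map_lie _ x y) }
  have h : S.val.comp (UniversalEnvelopingAlgebra.lift k g) = AlgHom.id k (U k) := by
    apply UniversalEnvelopingAlgebra.hom_ext
    ext x
    simp [g]
  rw [eq_top_iff]
  intro x _
  rw [← AlgHom.id_apply (R := k) x, ← h]
  exact Subtype.property _

/-- A linear map between `U`-modules that commutes with `e`, `h` and `f` is `U`-linear. -/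
def linearOfGenerators {V W : Type*} [AddCommGroup V] [AddCommGroup W] [Module k V] [Module k W]
    [Module (U k) V] [Module (U k) W] [IsScalarTower k (U k) V] [IsScalarTower k (U k) W]
    (φ : V →ₗ[k] W) (hE : ∀ v, φ (uE k • v) = uE k • φ v) (hH : ∀ v, φ (uH k • v) = uH k • φ v)
    (hF : ∀ v, φ (uF k • v) = uF k • φ v) : V →ₗ[U k] W where
  __ := φ
  map_smul' u v := by
    let S : Subalgebra k (U k) :=
      { carrier := {u | ∀ v, φ (u • v) = u • φ v}
        mul_mem' := fun {a b} ha hb v => by rw [mul_smul, mul_smul, ha, hb]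
        add_mem' := fun {a b} ha hb v => by rw [add_smul, add_smul, map_add, ha, hb]
        algebraMap_mem' := fun r v => by rw [algebraMap_smul, algebraMap_smul, map_smul] }
    have h : u ∈ S := by rw [subalgebra_eq_top S hE hH hF]; trivial
    exact h v

/-- A subspace containing `1` and stable under left multiplication by `e`, `h`, `f` is all of
the enveloping algebra. -/
theorem submodule_eq_top (W : Submodule k (U k)) (h1 : 1 ∈ W) (hE : ∀ w ∈ W, uE k * w ∈ W)
    (hH : ∀ w ∈ W, uH k * w ∈ W) (hF : ∀ w ∈ W, uF k * w ∈ W) : W = ⊤ := by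
  let S : Subalgebra k (U k) :=
    { carrier := {u | ∀ w ∈ W, u * w ∈ W}
      mul_mem' := fun {a b} ha hb v hv => by rw [mul_assoc]; exact ha _ (hb _ hv)
      add_mem' := fun {a b} ha hb v hv => by rw [add_mul]; exact W.add_mem (ha _ hv) (hb _ hv)
      algebraMap_mem' := fun r v hv => by rw [← Algebra.smul_def]; exact W.smul_mem _ hv }
  rw [eq_top_iff]
  intro x _
  have h : x ∈ S := by rw [subalgebra_eq_top S hE hH hF]; trivial
  simpa using h 1 h1

end Generators

/-! ### The action of the enveloping algebra on normal forms -/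

section PBW

universe u

open Polynomial

variable (k : Type u) [Field k]

/-- The space of normal forms `∑ f ^ a * g(h) * e ^ c`, where `g` is a polynomial: such a sum is
encoded as the function that sends `(a, c)` to the coefficient `g`. -/
def NormalForm : Type u := (ℕ × ℕ) →₀ k[X]

instance : AddCommGroup (NormalForm k) := inferInstanceAs (AddCommGroup ((ℕ × ℕ) →₀ k[X]))
instance : Module k (NormalForm k) := inferInstanceAs (Module k ((ℕ × ℕ) →₀ k[X]))

namespace NormalForm

variable {k}

/-- The normal form `f ^ a * g(h) * e ^ c`. -/
def mono (a c : ℕ) : k[X] →ₗ[k] NormalForm k := Finsupp.lsingle (a, c)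

/-- The coefficient of `f ^ a * _ * e ^ c`. -/
def coef (a c : ℕ) : NormalForm k →ₗ[k] k[X] := Finsupp.lapply (a, c)

/-- The linear map with prescribed values on normal forms `f ^ a * g(h) * e ^ c`. -/
def liftMono {W : Type*} [AddCommGroup W] [Module k W] (φ : ℕ → ℕ → k[X] →ₗ[k] W) :
    NormalForm k →ₗ[k] W :=
  Finsupp.lsum k fun ac : ℕ × ℕ => φ ac.1 ac.2

@[simp]
theorem liftMono_mono {W : Type*} [AddCommGroup W] [Module k W] (φ : ℕ → ℕ → k[X] →ₗ[k] W)
    (a c : ℕ) (g : k[X]) : liftMono φ (mono a c g) = φ a c g := by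
  simp only [liftMono, mono]
  exact Finsupp.sum_single_index (map_zero _)

theorem coef_mono (a c a' c' : ℕ) (g : k[X]) :
    coef a' c' (mono a c g) = if a = a' ∧ c = c' then g else 0 := by
  simp only [coef, mono]
  exact (Finsupp.single_apply (a := (a, c))).trans (if_congr Prod.ext_iff rfl rfl)

theorem hom_ext {W : Type*} [AddCommGroup W] [Module k W] {φ ψ : NormalForm k →ₗ[k] W}
    (h : ∀ a c g, φ (mono a c g) = ψ (mono a c g)) : φ = ψ :=
  Finsupp.lhom_ext fun ac g => h ac.1 ac.2 g

theorem ext_coef {v w : NormalForm k} (h : ∀ a c, coef a c v = coef a c w) : v = w :=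
  Finsupp.ext fun ac => h ac.1 ac.2

/-- The substitution `g(X) ↦ g(X - 2)`, which describes moving `e` or `f` past `g(h)`. -/
def shift : k[X] →ₐ[k] k[X] := aeval (X - C 2)

/-- Left multiplication by `e` on normal forms. -/
def opE : Module.End k (NormalForm k) := liftMono fun a c =>
  mono a (c + 1) ∘ₗ shift.toLinearMap +
    mono (a - 1) c ∘ₗ LinearMap.mulLeft k ((a : k[X]) * (X - ((a - 1 : ℕ) : k[X])))

/-- Left multiplication by `h` on normal forms. -/
def opH : Module.End k (NormalForm k) := liftMono fun a c =>
  mono a c ∘ₗ LinearMap.mulLeft k (X - 2 * (a : k[X]))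

/-- Left multiplication by `f` on normal forms. -/
def opF : Module.End k (NormalForm k) := liftMono fun a c => mono (a + 1) c

/-- Right multiplication by `e` on normal forms. -/
def rightE : Module.End k (NormalForm k) := liftMono fun a c => mono a (c + 1)

/-- Right multiplication by `h` on normal forms. -/
def rightH : Module.End k (NormalForm k) := liftMono fun a c =>
  mono a c ∘ₗ LinearMap.mulLeft k (X - 2 * (c : k[X]))

/-- Right multiplication by `f` on normal forms. -/
def rightF : Module.End k (NormalForm k) := liftMono fun a c =>
  mono (a + 1) c ∘ₗ shift.toLinearMap +
    mono a (c - 1) ∘ₗ LinearMap.mulLeft k ((c : k[X]) * (X - ((c - 1 : ℕ) : k[X])))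

section

variable (a c : ℕ) (g : k[X])

theorem opE_mono : opE (mono a c g) = mono a (c + 1) (shift g) +
    mono (a - 1) c ((a : k[X]) * (X - ((a - 1 : ℕ) : k[X])) * g) := by simp [opE, mul_assoc]

theorem opH_mono : opH (mono a c g) = mono a c ((X - 2 * (a : k[X])) * g) := by simp [opH]

theorem opF_mono : opF (mono a c g) = mono (a + 1) c g := by simp [opF]

theorem rightE_mono : rightE (mono a c g) = mono a (c + 1) g := by simp [rightE]

theorem rightH_mono : rightH (mono a c g) = mono a c ((X - 2 * (c : k[X])) * g) := by
  simp [rightH]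

theorem rightF_mono : rightF (mono a c g) = mono (a + 1) c (shift g) +
    mono a (c - 1) ((c : k[X]) * (X - ((c - 1 : ℕ) : k[X])) * g) := by simp [rightF, mul_assoc]

theorem shift_X : shift (X : k[X]) = X - 2 := by
  simp only [shift, aeval_X]; rfl

end

theorem opH_opE : opH * opE - opE * opH = (2 : k) • (opE : Module.End k (NormalForm k)) := by
  refine hom_ext fun a c g => ?_
  simp only [LinearMap.sub_apply, Module.End.mul_apply, LinearMap.smul_apply, opE_mono, opH_mono,
    map_add, map_mul, map_sub, shift_X, map_natCast, map_ofNat, smul_add, ← map_smul]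
  rw [add_sub_add_comm, ← map_sub, ← map_sub]
  simp only [ofNat_smul_eq_nsmul, nsmul_eq_mul, map_mul, map_natCast]
  cases a with
  | zero =>
    simp only [Nat.cast_zero, zero_mul, mul_zero, sub_zero, map_zero, add_zero]
    congr 1
    push_cast
    ring
  | succ a => congr 2 <;> push_cast [Nat.add_sub_cancel] <;> ring

theorem opH_opF : opH * opF - opF * opH = (-2 : k) • (opF : Module.End k (NormalForm k)) := by
  refine hom_ext fun a c g => ?_
  simp only [LinearMap.sub_apply, Module.End.mul_apply, LinearMap.smul_apply, opF_mono, opH_mono,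
    ← map_smul]
  rw [← map_sub, neg_smul, ofNat_smul_eq_nsmul, nsmul_eq_mul]
  congr 1
  push_cast
  ring

theorem opE_opF : opE * opF - opF * opE = (opH : Module.End k (NormalForm k)) := by
  refine hom_ext fun a c g => ?_
  simp only [LinearMap.sub_apply, Module.End.mul_apply, opF_mono, opH_mono, opE_mono, map_add]
  rw [add_sub_add_left_eq_sub]
  cases a with
  | zero => simp
  | succ a =>
    rw [Nat.add_sub_cancel, Nat.add_sub_cancel, ← map_sub]
    congr 1
    push_cast
    ring

instance : Module (U k) (NormalForm k) :=
  Module.compHom (NormalForm k)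
    (UniversalEnvelopingAlgebra.lift k
      (repOfTriple k opE opH opF opH_opE opH_opF opE_opF)).toRingHom

theorem smul_eq (u : U k) (v : NormalForm k) :
    u • v = UniversalEnvelopingAlgebra.lift k
      (repOfTriple k opE opH opF opH_opE opH_opF opE_opF) u v := rfl

instance : IsScalarTower k (U k) (NormalForm k) :=
  ⟨fun r u v => by rw [smul_eq, smul_eq, map_smul, LinearMap.smul_apply]⟩

theorem uE_smul (v : NormalForm k) : uE k • v = opE v := by
  rw [smul_eq, uE, UniversalEnvelopingAlgebra.lift_ι_apply]
  simp [repOfTriple, slE]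

theorem uH_smul (v : NormalForm k) : uH k • v = opH v := by
  rw [smul_eq, uH, UniversalEnvelopingAlgebra.lift_ι_apply]
  simp [repOfTriple, slH]

theorem uF_smul (v : NormalForm k) : uF k • v = opF v := by
  rw [smul_eq, uF, UniversalEnvelopingAlgebra.lift_ι_apply]
  simp [repOfTriple, slF]

end NormalForm
end PBW

/-! ### The Poincaré–Birkhoff–Witt theorem for `𝔰𝔩₂` -/

section PBW

universe u

open Polynomial

variable {k : Type u} [Field k]

namespace NormalForm

/-- The normal form of `1`. -/
def one : NormalForm k := mono 0 0 1

/-- Right multiplications are `U`-linear because they commute with the three left ones. -/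
theorem map_smul_of_comm (R : Module.End k (NormalForm k)) (hE : R * opE = opE * R)
    (hH : R * opH = opH * R) (hF : R * opF = opF * R) (u : U k) (v : NormalForm k) :
    R (u • v) = u • R v :=
  (linearOfGenerators R
    (fun v => by rw [uE_smul, uE_smul]; exact LinearMap.congr_fun hE v)
    (fun v => by rw [uH_smul, uH_smul]; exact LinearMap.congr_fun hH v)
    (fun v => by rw [uF_smul, uF_smul]; exact LinearMap.congr_fun hF v)).map_smul u v

theorem rightE_smul (u : U k) (v : NormalForm k) : rightE (u • v) = u • rightE v := by
  apply map_smul_of_comm <;> refine hom_ext fun a c g => ?_ <;>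
    simp [opE_mono, opH_mono, opF_mono, rightE_mono]

theorem rightH_smul (u : U k) (v : NormalForm k) : rightH (u • v) = u • rightH v := by
  apply map_smul_of_comm <;> refine hom_ext fun a c g => ?_
  · simp only [Module.End.mul_apply, opE_mono, rightH_mono, map_add, map_mul, map_sub, shift_X,
      map_natCast, map_ofNat]
    congr 2
    · push_cast; ring
    · ring
  · simp only [Module.End.mul_apply, opH_mono, rightH_mono]
    congr 1
    ring
  · simp only [Module.End.mul_apply, opF_mono, rightH_mono]

theorem rightF_smul (u : U k) (v : NormalForm k) : rightF (u • v) = u • rightF v := by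
  apply map_smul_of_comm <;> refine hom_ext fun a c g => ?_
  · simp only [Module.End.mul_apply, opE_mono, rightF_mono, map_add, map_mul, map_sub, shift_X,
      map_natCast]
    have ha : ∀ q : k[X], mono (a - 1 + 1) c ((a : k[X]) * q) = mono a c ((a : k[X]) * q) := by
      cases a <;> simp
    have hc : ∀ q : k[X], mono a (c - 1 + 1) ((c : k[X]) * q) = mono a c ((c : k[X]) * q) := by
      cases c <;> simp
    have hm : mono a c (((c + 1 : ℕ) : k[X]) * (X - ((c + 1 - 1 : ℕ) : k[X])) * shift g) +
          mono a c ((a : k[X]) * ((X - 2 - ((a - 1 : ℕ) : k[X])) * shift g)) =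
        mono a c (((a + 1 : ℕ) : k[X]) * (X - ((a + 1 - 1 : ℕ) : k[X])) * shift g) +
          mono a c ((c : k[X]) * ((X - 2 - ((c - 1 : ℕ) : k[X])) * shift g)) := by
      rw [← map_add, ← map_add]
      congr 1
      have hsub : ∀ n : ℕ, (n : k[X]) * ((n - 1 : ℕ) : k[X]) = n * n - n := by
        intro n
        cases n with
        | zero => simp
        | succ n => push_cast [Nat.add_sub_cancel]; ring
      rw [Nat.add_sub_cancel, Nat.add_sub_cancel]
      push_cast
      linear_combination (hsub c - hsub a) * shift g
    have h4 : mono (a - 1) (c - 1) ((c : k[X]) * (X - ((c - 1 : ℕ) : k[X])) *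
          ((a : k[X]) * (X - ((a - 1 : ℕ) : k[X])) * g)) =
        mono (a - 1) (c - 1) ((a : k[X]) * (X - ((a - 1 : ℕ) : k[X])) *
          ((c : k[X]) * (X - ((c - 1 : ℕ) : k[X])) * g)) := by
      congr 1
      ring
    rw [mul_assoc (a : k[X]) _ (shift g), mul_assoc (c : k[X]) _ (shift g), ha, hc, h4]
    simp only [Nat.add_sub_cancel] at hm ⊢
    linear_combination (norm := module) hm
  · simp only [Module.End.mul_apply, opH_mono, rightF_mono, map_add, map_mul, map_sub, shift_X,
      map_natCast, map_ofNat]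
    congr 2
    · push_cast; ring
    · ring
  · simp only [Module.End.mul_apply, opF_mono, rightF_mono, map_add]

theorem mul_uE_smul_one (u : U k) : (u * uE k) • (one : NormalForm k) = rightE (u • one) := by
  rw [mul_smul, rightE_smul, uE_smul]
  simp [one, opE_mono, rightE_mono]

theorem mul_uH_smul_one (u : U k) : (u * uH k) • (one : NormalForm k) = rightH (u • one) := by
  rw [mul_smul, rightH_smul, uH_smul]
  simp [one, opH_mono, rightH_mono]

theorem mul_uF_smul_one (u : U k) : (u * uF k) • (one : NormalForm k) = rightF (u • one) := by
  rw [mul_smul, rightF_smul, uF_smul]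
  simp [one, opF_mono, rightF_mono]

theorem uH_mul_uF_pow (a : ℕ) : uH k * uF k ^ a = uF k ^ a * (uH k - 2 * (a : U k)) := by
  induction a with
  | zero => simp
  | succ a ih =>
    have h2 : (2 : U k) * uF k = uF k * 2 := (Nat.cast_commute 2 (uF k)).eq
    have ha : (a : U k) * uF k = uF k * a := (Nat.cast_commute a (uF k)).eq
    rw [pow_succ, ← mul_assoc, ih, mul_assoc, sub_mul, uH_mul_uF, mul_assoc 2, ha,
      ← mul_assoc 2, h2]
    push_cast
    noncomm_ring

theorem uE_mul_uF_pow (a : ℕ) : uE k * uF k ^ (a + 1) =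
    uF k ^ (a + 1) * uE k + uF k ^ a * (((a + 1 : ℕ) : U k) * (uH k - (a : U k))) := by
  induction a with
  | zero => simp [uE_mul_uF]
  | succ a ih =>
    have ha : (uH k - (a : U k)) * uF k = uF k * (uH k - 2 - (a : U k)) := by
      have h2 : (2 : U k) * uF k = uF k * 2 := (Nat.cast_commute 2 (uF k)).eq
      rw [sub_mul, uH_mul_uF, (Nat.cast_commute a (uF k)).eq, h2, ← mul_sub, ← mul_sub]
    have hb : ((a + 1 : ℕ) : U k) * uF k = uF k * (a + 1 : ℕ) := (Nat.cast_commute _ (uF k)).eq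
    rw [pow_succ _ (a + 1), ← mul_assoc, ih, add_mul, mul_assoc _ (uE k), uE_mul_uF,
      mul_assoc _ _ (uF k), mul_assoc _ _ (uF k), ha, ← mul_assoc _ (uF k), hb, mul_add,
      ← mul_assoc _ (uF k) (uE k), add_assoc, mul_assoc (uF k), ← mul_assoc _ (uF k),
      ← pow_succ, ← pow_succ, ← mul_add]
    congr 2
    push_cast
    noncomm_ring

theorem uE_mul_aeval (g : k[X]) : uE k * aeval (uH k) g = aeval (uH k) (shift g) * uE k := by
  induction g using Polynomial.induction_on' with
  | add p q hp hq => simp only [map_add, mul_add, add_mul, hp, hq]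
  | monomial n r =>
    have hX : uE k * uH k = aeval (uH k) (shift (X : k[X])) * uE k := by
      rw [shift_X, map_sub, aeval_X, map_ofNat, sub_mul, uH_mul_uE]; abel
    have hn : ∀ n : ℕ, uE k * uH k ^ n = aeval (uH k) (shift (X ^ n : k[X])) * uE k := by
      intro n
      induction n with
      | zero => simp
      | succ n ih =>
        rw [pow_succ, ← mul_assoc, ih, mul_assoc, hX, pow_succ, map_mul, map_mul, mul_assoc]
    rw [← C_mul_X_pow_eq_monomial, ← smul_eq_C_mul, map_smul, map_smul, map_smul, aeval_X_pow,
      mul_smul_comm, smul_mul_assoc, hn]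

/-- The element of the enveloping algebra with a given normal form. -/
def toU : NormalForm k →ₗ[k] U k := liftMono fun a c =>
  LinearMap.mulLeft k (uF k ^ a) ∘ₗ LinearMap.mulRight k (uE k ^ c) ∘ₗ (aeval (uH k)).toLinearMap

theorem toU_mono (a c : ℕ) (g : k[X]) :
    toU (mono a c g) = uF k ^ a * (aeval (uH k) g * uE k ^ c) := by
  simp [toU]

theorem toU_smul (u : U k) (v : NormalForm k) : toU (u • v) = u * toU v := by
  refine (linearOfGenerators (W := U k) toU (fun v => ?_) (fun v => ?_) fun v => ?_).map_smul u v
  · rw [uE_smul, smul_eq_mul]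
    refine LinearMap.congr_fun (f := toU ∘ₗ opE) (g := LinearMap.mulLeft k (uE k) ∘ₗ toU)
      (hom_ext fun a c g => ?_) v
    simp only [LinearMap.comp_apply, LinearMap.mulLeft_apply, opE_mono, map_add, toU_mono]
    cases a with
    | zero => simp [← mul_assoc, uE_mul_aeval, pow_succ']
    | succ a =>
      rw [← mul_assoc (uE k), uE_mul_uF_pow, add_mul, mul_assoc _ (uE k), ← mul_assoc (uE k),
        uE_mul_aeval]
      simp [mul_assoc, pow_succ']
  · rw [uH_smul, smul_eq_mul]
    refine LinearMap.congr_fun (f := toU ∘ₗ opH) (g := LinearMap.mulLeft k (uH k) ∘ₗ toU)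
      (hom_ext fun a c g => ?_) v
    simp only [LinearMap.comp_apply, LinearMap.mulLeft_apply, opH_mono, toU_mono]
    rw [← mul_assoc (uH k), uH_mul_uF_pow]
    simp [mul_assoc, map_ofNat (aeval (uH k))]
  · rw [uF_smul, smul_eq_mul]
    refine LinearMap.congr_fun (f := toU ∘ₗ opF) (g := LinearMap.mulLeft k (uF k) ∘ₗ toU)
      (hom_ext fun a c g => ?_) v
    simp [opF_mono, toU_mono, pow_succ', mul_assoc]

/-- Normal forms exist: every element of `U` is recovered from its action on `1`. -/
theorem toU_smul_one (u : U k) : toU (u • one) = u := by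
  rw [toU_smul, one, toU_mono]
  simp

theorem smul_one_injective : Function.Injective fun u : U k => u • (one : NormalForm k) :=
  Function.LeftInverse.injective toU_smul_one

/-- Normal forms are unique: a normal form is recovered from the element of `U` it represents. -/
theorem toU_apply_smul_one (v : NormalForm k) : toU v • (one : NormalForm k) = v := by
  refine LinearMap.congr_fun (f := LinearMap.restrictScalars k
    (LinearMap.toSpanSingleton (U k) (NormalForm k) one) ∘ₗ toU) (g := LinearMap.id)
    (hom_ext fun a c g => ?_) v
  have hE : ∀ c : ℕ, uE k ^ c • (one : NormalForm k) = mono 0 c 1 := by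
    intro c
    induction c with
    | zero => simp [one]
    | succ c ih => rw [pow_succ', mul_smul, ih, uE_smul, opE_mono]; simp
  have hF : ∀ (a c : ℕ) (g : k[X]), uF k ^ a • (mono 0 c g) = mono a c g := by
    intro a c g
    induction a with
    | zero => simp
    | succ a ih => rw [pow_succ', mul_smul, ih, uF_smul, opF_mono]
  have hH : ∀ (c : ℕ) (g q : k[X]), aeval (uH k) g • (mono 0 c q) = mono 0 c (g * q) := by
    intro c g
    induction g using Polynomial.induction_on with
    | C r => intro q; rw [aeval_C, algebraMap_smul, ← map_smul, smul_eq_C_mul]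
    | add p q hp hq => intro q; rw [map_add, add_smul, hp, hq, add_mul, map_add]
    | monomial n r ih =>
      intro q
      rw [pow_succ, ← mul_assoc, map_mul, aeval_X, mul_smul, uH_smul, opH_mono, ih, mul_assoc _ X]
      simp
  simp [toU_mono, mul_smul, hE, hH, hF]

end NormalForm
end PBW

/-! ### Cancellation modulo left ideals -/

section PBW

universe u

open Polynomial

variable {k : Type u} [Field k]

namespace NormalForm

theorem coef_zero_rightE (a : ℕ) (v : NormalForm k) : coef a 0 (rightE v) = 0 := by
  refine LinearMap.congr_fun (f := coef a 0 ∘ₗ rightE) (g := 0) (hom_ext fun a' c g => ?_) v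
  simp [rightE_mono, coef_mono]

theorem coef_succ_rightE (a c : ℕ) (v : NormalForm k) :
    coef a (c + 1) (rightE v) = coef a c v := by
  refine LinearMap.congr_fun (f := coef a (c + 1) ∘ₗ rightE) (g := coef a c)
    (hom_ext fun a' c' g => ?_) v
  simp [rightE_mono, coef_mono]

theorem rightE_injective : Function.Injective (rightE : Module.End k (NormalForm k)) :=
  fun v w h => ext_coef fun a c => by rw [← coef_succ_rightE, h, coef_succ_rightE]

/-- The left ideal `U e` consists of the normal forms without terms free of `e`. -/
theorem exists_rightE_eq (v : NormalForm k) (hv : ∀ a, coef a 0 v = 0) :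
    ∃ w, rightE w = v := by
  let L : Module.End k (NormalForm k) :=
    liftMono fun a c => if c = 0 then 0 else mono a (c - 1)
  refine ⟨L v, ext_coef fun a c => ?_⟩
  cases c with
  | zero => rw [hv, coef_zero_rightE]
  | succ c =>
    rw [coef_succ_rightE]
    refine LinearMap.congr_fun (f := coef a c ∘ₗ L) (g := coef a (c + 1))
      (hom_ext fun a' c' g => ?_) v
    cases c' <;> simp [L, coef_mono]

theorem coef_zero_rightH (a : ℕ) (v : NormalForm k) :
    coef a 0 (rightH v) = X * coef a 0 v := by
  refine LinearMap.congr_fun (f := coef a 0 ∘ₗ rightH) (g := LinearMap.mulLeft k X ∘ₗ coef a 0)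
    (hom_ext fun a' c g => ?_) v
  simp only [LinearMap.comp_apply, rightH_mono, coef_mono, LinearMap.mulLeft_apply, mul_ite,
    mul_zero]
  split_ifs with h
  · simp [h.2]
  · rfl

theorem coef_succ_zero_rightF (a : ℕ) (v : NormalForm k) :
    coef (a + 1) 0 (rightF v) = shift (coef a 0 v) + X * coef (a + 1) 1 v := by
  refine LinearMap.congr_fun (f := coef (a + 1) 0 ∘ₗ rightF)
    (g := shift.toLinearMap ∘ₗ coef a 0 + LinearMap.mulLeft k X ∘ₗ coef (a + 1) 1)
    (hom_ext fun a' c g => ?_) v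
  simp only [LinearMap.comp_apply, rightF_mono, map_add, coef_mono, LinearMap.add_apply,
    AlgHom.toLinearMap_apply, LinearMap.mulLeft_apply]
  rcases c with _ | _ | c
  · simp [apply_ite (shift (k := k))]
  · simp
  · simp

end NormalForm

open NormalForm

theorem eq_zero_of_mul_uE {u : U k} (h : u * uE k = 0) : u = 0 := by
  apply smul_one_injective
  apply rightE_injective
  simp only [← mul_uE_smul_one, h, zero_mul]

/-- Right multiplication by `h + m` is injective on `U / U e`, a free right `k[h]`-module. -/
theorem mem_of_mul_uH_add {u v : U k} (m : ℕ) (h : u * (uH k + (m : U k)) = v * uE k) :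
    ∃ w, u = w * uE k := by
  have h' := congrArg (fun x : U k => x • (one : NormalForm k)) h
  simp only [mul_add, add_smul, mul_uH_smul_one, mul_uE_smul_one,
    ← (Nat.cast_commute m u).eq] at h'
  rw [mul_smul, Nat.cast_smul_eq_nsmul] at h'
  obtain ⟨w, hw⟩ := exists_rightE_eq (u • (one : NormalForm k)) fun a => by
    have := congrArg (coef a 0) h'
    rw [map_add, coef_zero_rightH, map_nsmul, coef_zero_rightE, nsmul_eq_mul, ← add_mul] at this
    refine (mul_eq_zero.1 this).resolve_left ?_
    rw [← C_eq_natCast]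
    exact X_add_C_ne_zero _
  refine ⟨toU w, smul_one_injective ?_⟩
  simp only [mul_uE_smul_one, toU_apply_smul_one, hw]

/-- Right multiplication by `f` is injective from `U / (U e + U (h + 2))` to `U / (U e + U h)`, that
is, on Verma modules of highest weights `-2` and `0`. -/
theorem mem_of_mul_uF {u v w : U k} (h : u * uF k = v * uE k + w * uH k) :
    ∃ x y, u = x * uE k + y * (uH k + 2) := by
  have h' := congrArg (fun x : U k => x • (one : NormalForm k)) h
  simp only [add_smul, mul_uH_smul_one, mul_uE_smul_one, mul_uF_smul_one] at h'
  -- The coefficient of `f ^ a` modulo `U e` vanishes at `-2`, hence is divisible by `X + 2`.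
  have hdvd : ∀ a, (X + C 2) ∣ coef a 0 (u • (one : NormalForm k)) := fun a => by
    have := congrArg (fun z => (coef (a + 1) 0 z).eval 0) h'
    simp only [map_add, coef_succ_zero_rightF, coef_zero_rightE, coef_zero_rightH] at this
    have h0 : (shift (coef a 0 (u • (one : NormalForm k)))).eval 0 = 0 := by simpa using this
    rw [show ∀ g : k[X], shift g = g.comp (X - C 2) from fun _ => rfl, eval_comp] at h0
    rw [← sub_neg_eq_add, ← C_neg, dvd_iff_isRoot]
    simpa using h0
  let y : NormalForm k := Finsupp.mapRange (fun g : k[X] => g /ₘ (X + C 2)) (zero_divByMonic _)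
    (u • (one : NormalForm k))
  have hy : ∀ a c, coef a c y = coef a c (u • (one : NormalForm k)) /ₘ (X + C 2) :=
    fun a c => rfl
  obtain ⟨x, hx⟩ := exists_rightE_eq (u • (one : NormalForm k) - (rightH y + (2 : ℕ) • y))
    fun a => by
      rw [map_sub, map_add, coef_zero_rightH, map_nsmul, nsmul_eq_mul, ← add_mul, hy,
        ← C_eq_natCast, Nat.cast_ofNat, sub_eq_zero]
      obtain ⟨q, hq⟩ := hdvd a
      rw [hq, mul_divByMonic_cancel_left q (monic_X_add_C 2)]
  refine ⟨toU x, toU y, smul_one_injective ?_⟩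
  have h2 : (2 : U k) = ((2 : ℕ) : U k) := by norm_num
  simp only [add_smul, mul_uE_smul_one, mul_add, mul_uH_smul_one, toU_apply_smul_one, hx]
  rw [h2, ← (Nat.cast_commute 2 (toU y)).eq, mul_smul, Nat.cast_smul_eq_nsmul, toU_apply_smul_one]
  abel

end PBW

/-! ### The Chevalley–Eilenberg resolution and coinvariants -/

section Koszul

universe u

variable (k : Type u) [Field k]

/-- The differential `U ⊗ 𝔤 → U` of the Chevalley–Eilenberg complex, in the basis `e, h, f`. -/
def ceD₁ : U k × U k × U k →ₗ[U k] U k where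
  toFun x := x.1 * uE k + x.2.1 * uH k + x.2.2 * uF k
  map_add' x y := by simp only [Prod.fst_add, Prod.snd_add, add_mul]; abel
  map_smul' r x := by simp [mul_add, mul_assoc]

/-- The differential `U ⊗ Λ²𝔤 → U ⊗ 𝔤` of the Chevalley–Eilenberg complex, in the bases
`e ∧ h, e ∧ f, h ∧ f` and `e, h, f`. -/
def ceD₂ : U k × U k × U k →ₗ[U k] U k × U k × U k where
  toFun x := (x.1 * (2 - uH k) - x.2.1 * uF k, x.1 * uE k - x.2.1 - x.2.2 * uF k,
    x.2.1 * uE k + x.2.2 * (uH k + 2))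
  map_add' x y := by
    simp only [Prod.fst_add, Prod.snd_add, add_mul, Prod.mk_add_mk, Prod.mk.injEq]
    refine ⟨?_, ?_, ?_⟩ <;> abel
  map_smul' r x := by simp [mul_add, mul_sub, mul_assoc]

/-- The differential `U ⊗ Λ³𝔤 → U ⊗ Λ²𝔤` of the Chevalley–Eilenberg complex, in the bases
`e ∧ h ∧ f` and `e ∧ h, e ∧ f, h ∧ f`. -/
def ceD₃ : U k →ₗ[U k] U k × U k × U k where
  toFun u := (u * uF k, -(u * uH k), u * uE k)
  map_add' x y := by simp [add_mul, add_comm]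
  map_smul' r x := by simp [mul_assoc]

/-- The augmentation of the enveloping algebra. -/
def augmentation : U k →ₗ[U k] trivialModule k :=
  LinearMap.toSpanSingleton (U k) (trivialModule k) (1 : k)

variable {k}

theorem augmentation_apply (u : U k) : augmentation k u =
    UniversalEnvelopingAlgebra.lift k (0 : sl2 k →ₗ⁅k⁆ Module.End k k) u (1 : k) := rfl

theorem ceD₃_injective : Function.Injective (ceD₃ k) := by
  refine (injective_iff_map_eq_zero _).2 fun u hu => ?_
  exact eq_zero_of_mul_uE (congrArg (fun z => z.2.2) hu)

theorem ceD₂_ceD₃ (u : U k) : ceD₂ k (ceD₃ k u) = 0 := by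
  have h2 : ∀ x : U k, 2 * x = x * 2 := fun x => (Nat.cast_commute 2 x).eq
  simp only [ceD₂, ceD₃, LinearMap.coe_mk, AddHom.coe_mk, Prod.mk_eq_zero]
  refine ⟨?_, ?_, ?_⟩
  · rw [neg_mul, mul_assoc, mul_assoc, uH_mul_uF, ← mul_neg, ← mul_sub, h2]
    noncomm_ring
  · rw [mul_assoc, mul_assoc, uE_mul_uF]
    noncomm_ring
  · rw [neg_mul, mul_assoc, mul_assoc, uH_mul_uE, h2]
    noncomm_ring

theorem ceD₁_ceD₂ (x : U k × U k × U k) : ceD₁ k (ceD₂ k x) = 0 := by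
  have h2 : ∀ x : U k, 2 * x = x * 2 := fun x => (Nat.cast_commute 2 x).eq
  obtain ⟨a, b, c⟩ := x
  simp only [ceD₁, ceD₂, LinearMap.coe_mk, AddHom.coe_mk, sub_mul, add_mul, mul_assoc, uH_mul_uE,
    uH_mul_uF, uE_mul_uF, h2]
  noncomm_ring

theorem augmentation_ceD₁ (x : U k × U k × U k) : augmentation k (ceD₁ k x) = 0 := by
  rw [augmentation_apply]
  simp [ceD₁, uE, uH, uF]
  rfl

theorem exact_ceD₃_ceD₂ : Function.Exact (ceD₃ k) (ceD₂ k) := by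
  rintro ⟨a, b, c⟩
  refine ⟨fun h => ?_, fun ⟨u, hu⟩ => by rw [← hu, ceD₂_ceD₃]⟩
  have h3 : b * uE k + c * (uH k + 2) = 0 := congrArg (fun z => z.2.2) h
  obtain ⟨w, rfl⟩ := mem_of_mul_uH_add (u := c) (v := -b) 2 (by
    rw [Nat.cast_ofNat, neg_mul]; exact (neg_eq_of_add_eq_zero_right h3).symm)
  -- After subtracting the boundary of `w`, the components vanish one after the other.
  have h' : ceD₂ k ((a, b, w * uE k) - ceD₃ k w) = 0 := by rw [map_sub, h, ceD₂_ceD₃, sub_zero]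
  have hb : b - -(w * uH k) = 0 := eq_zero_of_mul_uE (by
    simpa [ceD₂, ceD₃] using congrArg (fun z => z.2.2) h')
  have ha : a - w * uF k = 0 := eq_zero_of_mul_uE (by
    have := congrArg (fun z => z.2.1) h'
    simp only [ceD₂, ceD₃, LinearMap.coe_mk, AddHom.coe_mk, Prod.mk_sub_mk, hb, sub_self, zero_mul,
      sub_zero, Prod.snd_zero, Prod.fst_zero] at this
    exact this)
  refine ⟨w, ?_⟩
  rw [sub_eq_zero] at ha hb
  rw [ha, hb]
  rfl

theorem exact_ceD₂_ceD₁ : Function.Exact (ceD₂ k) (ceD₁ k) := by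
  rintro ⟨a, b, c⟩
  refine ⟨fun h => ?_, fun ⟨u, hu⟩ => by rw [← hu, ceD₁_ceD₂]⟩
  have h1 : a * uE k + b * uH k + c * uF k = 0 := h
  obtain ⟨x, y, hc⟩ := mem_of_mul_uF (u := c) (v := -a) (w := -b) (by
    rw [neg_mul, neg_mul, ← neg_add]; exact (neg_eq_of_add_eq_zero_right h1).symm)
  -- Subtracting a boundary removes the last component, then another one the middle component.
  obtain ⟨b', hb'⟩ : ∃ b', b' = b - (ceD₂ k (0, x, y)).2.1 := ⟨_, rfl⟩
  obtain ⟨a', ha'⟩ : ∃ a', a' = a - (ceD₂ k (0, x, y)).1 := ⟨_, rfl⟩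
  have e₁ : (a, b, c) = ceD₂ k (0, x, y) + (a', b', 0) := by
    rw [ha', hb', hc]
    refine Prod.ext ?_ (Prod.ext ?_ ?_) <;> simp [ceD₂]
  rw [e₁, map_add, ceD₁_ceD₂, zero_add] at h
  have h2 : a' * uE k + b' * uH k = 0 := by simpa [ceD₁] using h
  obtain ⟨w, rfl⟩ := mem_of_mul_uH_add (u := b') (v := -a') 0 (by
    rw [Nat.cast_zero, add_zero, neg_mul]; exact (neg_eq_of_add_eq_zero_right h2).symm)
  have e₂ : (a', w * uE k, 0) = ceD₂ k (w, 0, 0) + (a' - w * (2 - uH k), 0, 0) := by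
    refine Prod.ext ?_ (Prod.ext ?_ ?_) <;> simp [ceD₂]
  rw [e₂, map_add, ceD₁_ceD₂, zero_add] at h
  have ha : a' - w * (2 - uH k) = 0 := eq_zero_of_mul_uE (by simpa [ceD₁] using h)
  refine ⟨(0, x, y) + (w, 0, 0), ?_⟩
  rw [e₁, e₂, map_add, ha]
  simp

theorem exact_ceD₁_augmentation : Function.Exact (ceD₁ k) (augmentation k) := by
  intro u
  refine ⟨fun h => ?_, fun ⟨x, hx⟩ => by rw [← hx, augmentation_ceD₁]⟩
  have hW : u ∈ LinearMap.range (Algebra.linearMap k (U k)) ⊔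
      (LinearMap.range (ceD₁ k)).restrictScalars k := by
    rw [submodule_eq_top (LinearMap.range (Algebra.linearMap k (U k)) ⊔
      (LinearMap.range (ceD₁ k)).restrictScalars k)]
    · trivial
    · exact Submodule.mem_sup_left ⟨1, by simp⟩
    all_goals
      intro w hw
      obtain ⟨_, ⟨r, rfl⟩, _, ⟨x, rfl⟩, rfl⟩ := Submodule.mem_sup.1 hw
      refine Submodule.mem_sup_right ?_
      rw [mul_add, ← smul_eq_mul (a := _) (b := ceD₁ k x), ← map_smul]
      refine Submodule.add_mem _ ?_ ⟨_, rfl⟩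
    · exact ⟨(algebraMap k _ r, 0, 0), by simp [ceD₁, Algebra.commutes]⟩
    · exact ⟨(0, algebraMap k _ r, 0), by simp [ceD₁, Algebra.commutes]⟩
    · exact ⟨(0, 0, algebraMap k _ r), by simp [ceD₁, Algebra.commutes]⟩
  obtain ⟨_, ⟨r, rfl⟩, _, ⟨x, rfl⟩, rfl⟩ := Submodule.mem_sup.1 hW
  rw [map_add, augmentation_ceD₁, add_zero, augmentation_apply] at h
  have h' : UniversalEnvelopingAlgebra.lift k (0 : sl2 k →ₗ⁅k⁆ Module.End k k)
    (algebraMap k (U k) r) (1 : k) = 0 := h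
  have hr : r = 0 := by simpa using h'
  exact ⟨x, by simp [hr]⟩

theorem augmentation_surjective : Function.Surjective (augmentation k) := by
  intro r
  have h : ∀ r : k, UniversalEnvelopingAlgebra.lift k (0 : sl2 k →ₗ⁅k⁆ Module.End k k)
    (algebraMap k (U k) r) (1 : k) = r := fun r => by simp
  exact ⟨algebraMap k (U k) _, h r⟩

variable {M : Type u} [AddCommGroup M] [Module k M] (ρ : sl2 k →ₗ⁅k⁆ Module.End k M)

/-- `Ext³(k, A)` is the space of coinvariants, for a `U`-module `A` whose action is given by the
representation `ρ`. -/
theorem exists_surjective_ext_three_of_addEquiv (A : ModuleCat.{u} (U k)) (e : M ≃+ A)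
    (he : ∀ (u : U k) (m : M), u • e m = e (UniversalEnvelopingAlgebra.lift k ρ u m)) :
    ∃ Φ : M →ₗ[k] Abelian.Ext (trivialModule k) A 3,
      Function.Surjective Φ ∧
      ∀ m, Φ m = 0 ↔ ∃ a b c, m = ρ (slE k) a + ρ (slH k) b + ρ (slF k) c := by
  have hE : ∀ m, uE k • e m = e (ρ (slE k) m) := fun m => by
    rw [he, uE, UniversalEnvelopingAlgebra.lift_ι_apply]
  have hH : ∀ m, uH k • e m = e (ρ (slH k) m) := fun m => by
    rw [he, uH, UniversalEnvelopingAlgebra.lift_ι_apply]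
  have hF : ∀ m, uF k • e m = e (ρ (slF k) m) := fun m => by
    rw [he, uF, UniversalEnvelopingAlgebra.lift_ι_apply]
  have hr : ∀ (r : k) m, e (r • m) = r • e m := fun r m => by
    rw [← algebraMap_smul (U k) r (e m), he, AlgHom.commutes]
    rfl
  obtain ⟨Φ, hΦ, hker⟩ := exists_surjective_ext_three (k := k) (ceD₃ k) (ceD₂ k) (ceD₁ k)
    (augmentation k) ceD₃_injective exact_ceD₃_ceD₂ exact_ceD₂_ceD₁ exact_ceD₁_augmentation
    augmentation_surjective A
  let ev : M →ₗ[k] (ModuleCat.of (U k) (U k) ⟶ A) :=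
    { toFun m := ModuleCat.ofHom (LinearMap.toSpanSingleton (U k) A (e m))
      map_add' x y := by
        ext
        simp
      map_smul' r x := by
        ext
        simp [hr] }
  have hev : Function.Surjective ev := fun g => ⟨e.symm (g.hom 1), by
    ext
    simp [ev]⟩
  refine ⟨Φ ∘ₗ ev, hΦ.comp hev, fun m => ?_⟩
  rw [LinearMap.comp_apply, hker]
  constructor
  · rintro ⟨g, hg⟩
    refine ⟨e.symm (g.hom (0, 0, 1)), e.symm (g.hom (0, -1, 0)),
      e.symm (g.hom (1, 0, 0)), e.injective ?_⟩
    have h1 : e m = g.hom (ceD₃ k 1) := by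
      have := congrArg (fun φ => φ.hom (1 : U k)) hg
      simpa [ev] using this.symm
    rw [map_add, map_add, ← hE, ← hH, ← hF, h1]
    simp only [AddEquiv.apply_symm_apply, ← map_smul, ← map_add]
    congr 1
    simp [ceD₃]
  · rintro ⟨a, b, c, rfl⟩
    refine ⟨ModuleCat.ofHom
      ((LinearMap.toSpanSingleton (U k) A (e c)).coprod
        ((LinearMap.toSpanSingleton (U k) A (-e b)).coprod
          (LinearMap.toSpanSingleton (U k) A (e a)))), ?_⟩
    ext
    simp only [ev, ceD₃, map_add]
    simp [hE, hH, hF]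
    abel

/-- `Ext³(k, M)` is the space of coinvariants of `M`. -/
theorem exists_surjective_ext_three_envModule :
    ∃ Φ : M →ₗ[k] Abelian.Ext (trivialModule k) (envModule k (sl2 k) ρ) 3,
      Function.Surjective Φ ∧
      ∀ m, Φ m = 0 ↔ ∃ a b c, m = ρ (slE k) a + ρ (slH k) b + ρ (slF k) c :=
  exists_surjective_ext_three_of_addEquiv ρ (envModule k (sl2 k) ρ) (AddEquiv.refl M)
    fun _ _ => rfl

end Koszul

/-! ### Monomials in the symmetric algebra -/

section Monomials

universe u

variable (k : Type u) [Field k]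

/-- The basis `e, h, f` of `𝔰𝔩₂`. -/
def slBasis : Module.Basis (Fin 3) k (sl2 k) := .ofEquivFun
  { toFun x := ![x.1 0 1, x.1 0 0, x.1 1 0]
    invFun v := v 0 • slE k + v 1 • slH k + v 2 • slF k
    map_add' x y := by ext i; fin_cases i <;> rfl
    map_smul' r x := by ext i; fin_cases i <;> rfl
    left_inv x := (sl2_eq k x).symm
    right_inv v := by ext i; fin_cases i <;> simp [slE, slH, slF] }

theorem slBasis_apply (i : Fin 3) : slBasis k i = ![slE k, slH k, slF k] i := by
  rw [slBasis, Module.Basis.coe_ofEquivFun]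
  change (Pi.single i 1 : Fin 3 → k) 0 • slE k + (Pi.single i 1 : Fin 3 → k) 1 • slH k +
    (Pi.single i 1 : Fin 3 → k) 2 • slF k = _
  fin_cases i <;> simp

/-- The monomial `e ^ a * h ^ b * f ^ c` of the symmetric algebra. -/
def symMono (a b c : ℕ) : SymmetricAlgebra k (sl2 k) :=
  SymmetricAlgebra.ι k (sl2 k) (slE k) ^ a * SymmetricAlgebra.ι k (sl2 k) (slH k) ^ b *
    SymmetricAlgebra.ι k (sl2 k) (slF k) ^ c

theorem symMono_mem (a b c : ℕ) : symMono k a b c ∈ SymPow k (sl2 k) (a + b + c) := by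
  rw [SymPow, pow_add, pow_add]
  have h : ∀ (x : sl2 k) (m : ℕ), SymmetricAlgebra.ι k (sl2 k) x ^ m ∈
      LinearMap.range (SymmetricAlgebra.ι k (sl2 k)) ^ m :=
    fun x m => Submodule.pow_mem_pow _ (LinearMap.mem_range_self _ x) m
  exact Submodule.mul_mem_mul (Submodule.mul_mem_mul (h _ a) (h _ b)) (h _ c)

theorem symPow_le_span (n : ℕ) : SymPow k (sl2 k) n ≤
    Submodule.span k {s | ∃ a b c, a + b + c = n ∧ s = symMono k a b c} := by
  induction n with
  | zero =>
    rw [SymPow, pow_zero, Submodule.one_le]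
    exact Submodule.subset_span ⟨0, 0, 0, rfl, by simp [symMono]⟩
  | succ n ih =>
    rw [SymPow, pow_succ, Submodule.mul_le]
    rintro s hs _ ⟨x, rfl⟩
    replace hs := ih hs
    induction hs using Submodule.span_induction with
    | mem s h =>
      obtain ⟨a, b, c, rfl, rfl⟩ := h
      rw [sl2_eq k x, map_add, map_add, map_smul, map_smul, map_smul, mul_add, mul_add,
        mul_smul_comm, mul_smul_comm, mul_smul_comm]
      refine Submodule.add_mem _ (Submodule.add_mem _ ?_ ?_) ?_ <;>
        refine Submodule.smul_mem _ _ (Submodule.subset_span ?_)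
      · exact ⟨a + 1, b, c, by omega, by simp only [symMono]; ring⟩
      · exact ⟨a, b + 1, c, by omega, by simp only [symMono]; ring⟩
      · exact ⟨a, b, c + 1, by omega, by simp only [symMono]; ring⟩
    | zero => rw [zero_mul]; exact Submodule.zero_mem _
    | add s t _ _ hs ht => rw [add_mul]; exact Submodule.add_mem _ hs ht
    | smul r s _ hs => rw [smul_mul_assoc]; exact Submodule.smul_mem _ _ hs

/-- Linear functionals on the symmetric algebra may be prescribed on monomials. -/
theorem exists_functional (w : ℕ → ℕ → ℕ → k) :
    ∃ φ : SymmetricAlgebra k (sl2 k) →ₗ[k] k, ∀ a b c, φ (symMono k a b c) = w a b c := by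
  refine ⟨((MvPolynomial.basisMonomials (Fin 3) k).constr k fun d => w (d 0) (d 1) (d 2)) ∘ₗ
    (SymmetricAlgebra.equivMvPolynomial (slBasis k)).toLinearMap, fun a b c => ?_⟩
  have hX : ∀ i, SymmetricAlgebra.equivMvPolynomial (slBasis k)
      (SymmetricAlgebra.ι k (sl2 k) (![slE k, slH k, slF k] i)) = MvPolynomial.X i := fun i => by
    rw [← slBasis_apply, SymmetricAlgebra.equivMvPolynomial_ι_apply]
  have h : SymmetricAlgebra.equivMvPolynomial (slBasis k) (symMono k a b c) =
      MvPolynomial.basisMonomials (Fin 3) k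
        (Finsupp.single 0 a + Finsupp.single 1 b + Finsupp.single 2 c) := by
    rw [symMono, map_mul, map_mul, map_pow, map_pow, map_pow]
    erw [hX 0, hX 1, hX 2]
    simp [MvPolynomial.X_pow_eq_monomial, MvPolynomial.monomial_mul]
  rw [LinearMap.comp_apply]
  erw [h, Module.Basis.constr_basis]
  simp

theorem adDer_slE (a b c : ℕ) : adDer k (sl2 k) (slE k) (symMono k a b c) =
    (c : k) • symMono k a (b + 1) (c - 1) - (2 * b : k) • symMono k (a + 1) (b - 1) c := by
  have he : ⁅slE k, slE k⁆ = 0 := lie_self _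
  have hh : ⁅slE k, slH k⁆ = (-2 : k) • slE k := by rw [← lie_skew, lie_slH_slE, neg_smul]
  simp only [symMono, Derivation.leibniz, Derivation.leibniz_pow, adDer_ι, he, hh, lie_slE_slF,
    map_zero, map_smul, smul_eq_mul, Algebra.smul_def, eq_natCast, map_mul, map_natCast, map_neg,
    map_ofNat, pow_succ]
  ring

theorem adDer_slF (a b c : ℕ) : adDer k (sl2 k) (slF k) (symMono k a b c) =
    (2 * b : k) • symMono k a (b - 1) (c + 1) - (a : k) • symMono k (a - 1) (b + 1) c := by
  have hf : ⁅slF k, slF k⁆ = 0 := lie_self _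
  have hh : ⁅slF k, slH k⁆ = (2 : k) • slF k := by
    rw [← lie_skew, lie_slH_slF, neg_smul, neg_neg]
  have he : ⁅slF k, slE k⁆ = -slH k := by rw [← lie_skew, lie_slE_slF]
  simp only [symMono, Derivation.leibniz, Derivation.leibniz_pow, adDer_ι, he, hh, hf,
    map_zero, map_smul, smul_eq_mul, Algebra.smul_def, eq_natCast, map_mul, map_natCast, map_neg,
    map_ofNat, pow_succ]
  ring

theorem adDer_slH (a b c : ℕ) : adDer k (sl2 k) (slH k) (symMono k a b c) =
    (2 * (a - c) : k) • symMono k a b c := by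
  have hh : ⁅slH k, slH k⁆ = 0 := lie_self _
  have h : ∀ (n : ℕ) (x : SymmetricAlgebra k (sl2 k)), (n : SymmetricAlgebra k (sl2 k)) *
      (x ^ (n - 1) * x) = n * x ^ n := by
    intro n x
    cases n with
    | zero => simp
    | succ n => rw [Nat.add_sub_cancel, pow_succ]
  simp only [symMono, Derivation.leibniz, Derivation.leibniz_pow, adDer_ι, hh, lie_slH_slE,
    lie_slH_slF, map_zero, map_smul, smul_eq_mul, Algebra.smul_def, eq_natCast, map_mul,
    map_natCast, map_neg, map_ofNat, map_sub]
  linear_combination 2 * SymmetricAlgebra.ι k (sl2 k) (slH k) ^ b *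
    (SymmetricAlgebra.ι k (sl2 k) (slF k) ^ c * h a (SymmetricAlgebra.ι k (sl2 k) (slE k)) -
      SymmetricAlgebra.ι k (sl2 k) (slE k) ^ a * h c (SymmetricAlgebra.ι k (sl2 k) (slF k)))

end Monomials

/-! ### Invariant functionals on symmetric powers -/

section Independence

variable (k : Type*) [Field k]

/-- The values, on the chain of monomials `e ^ (a₀ + i) * h ^ (b₀ - 2 * i) * f ^ (c₀ + i)`, of the
invariant functional that takes the value `1` at `i = 0`. When a denominator vanishes the
functional is cut off, which is what the convention `x / 0 = 0` yields. -/
def chainWeight (b₀ c₀ i : ℕ) : k :=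
  ∏ l ∈ Finset.range i, ((c₀ + l + 1 : ℕ) : k) / (2 * ((b₀ : k) + 1 - 2 * (l + 1 : ℕ)))

/-- The weights of a chain as a function of the exponent of `f`, which starts at `c₀`. -/
def chainValue (b₀ c₀ c : ℕ) : k :=
  if c₀ ≤ c then chainWeight k b₀ c₀ (c - c₀) else 0

/-- The value on `e ^ a * h ^ b * f ^ c` of the invariant functional on degree `n` attached to
`(a₀, b₀, c₀)`; it is supported on the monomials with `a - c = a₀ - c₀` and `c₀ ≤ c`. -/
def weight (n a₀ b₀ c₀ a b c : ℕ) : k :=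
  if a + c₀ = c + a₀ ∧ a + b + c = n then chainValue k b₀ c₀ c else 0

variable {k}

theorem weight_self {n a₀ b₀ c₀ : ℕ} (h : a₀ + b₀ + c₀ = n) :
    weight k n a₀ b₀ c₀ a₀ b₀ c₀ = 1 := by
  rw [weight, if_pos ⟨add_comm _ _, h⟩, chainValue, if_pos le_rfl, Nat.sub_self]
  rfl

variable {p : ℕ} [CharP k p]

theorem chainWeight_succ (b₀ c₀ i : ℕ) : chainWeight k b₀ c₀ (i + 1) = chainWeight k b₀ c₀ i *
    (((c₀ + i + 1 : ℕ) : k) / (2 * ((b₀ : k) + 1 - 2 * (i + 1 : ℕ)))) := by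
  rw [chainWeight, Finset.prod_range_succ, chainWeight]

theorem natCast_ne_zero_of_not_dvd {m : ℕ} (h : ¬p ∣ m) : (m : k) ≠ 0 :=
  (CharP.cast_eq_zero_iff k p m).not.2 h

theorem two_ne_zero_of_two_lt (p : ℕ) [CharP k p] (hp : 2 < p) : (2 : k) ≠ 0 := by
  have := natCast_ne_zero_of_not_dvd (k := k) (p := p) (m := 2)
    fun h => absurd (Nat.le_of_dvd two_pos h) (by omega)
  exact_mod_cast this

theorem dvd_of_two_mul_natCast_eq_zero (hp : 2 < p) {m : ℕ} (h : (2 * m : k) = 0) : p ∣ m :=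
  (CharP.cast_eq_zero_iff k p m).1
    ((mul_eq_zero.1 h).resolve_left (two_ne_zero_of_two_lt p hp))

/-- The condition on a triple `(a₀, b₀, c₀)` of sum `n` for its monomial to belong to the basis of
the coinvariants of `Sⁿ`: either a chain of monomials breaks there, or the monomial is `h ^ n` with
`n ≤ p - 3` even. -/
def IsSource (p n a₀ b₀ c₀ : ℕ) : Prop :=
  a₀ + b₀ + c₀ = n ∧
    ((p ∣ b₀ + 1 ∧ a₀ ≡ c₀ [MOD p]) ∨ (a₀ = 0 ∧ c₀ = 0 ∧ b₀ + 3 ≤ p ∧ Even b₀))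

theorem chainWeight_relation (hp : 2 < p) {n a₀ b₀ c₀ : ℕ} (h : IsSource p n a₀ b₀ c₀) {i b : ℕ}
    (hb : b + 2 * (i + 1) = b₀ + 1) :
    2 * (b : k) * chainWeight k b₀ c₀ (i + 1) =
      ((c₀ + i + 1 : ℕ) : k) * chainWeight k b₀ c₀ i := by
  have hb' : (b₀ : k) + 1 - 2 * (i + 1 : ℕ) = b := by
    have : ((b + 2 * (i + 1) : ℕ) : k) = (b₀ + 1 : ℕ) := by rw [hb]
    push_cast at this ⊢
    rw [← this]; ring
  have h2 := two_ne_zero_of_two_lt (k := k) p hp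
  rw [chainWeight_succ, hb']
  by_cases hb0 : (b : k) = 0
  · -- The chain is cut here, which needs `(c₀ + i + 1) * chainWeight i` to vanish: at least `p`
    -- consecutive integers end in `c₀ + i + 1`, and one of them is a multiple of `p`.
    rw [hb0, mul_zero, zero_mul, eq_comm]
    have hpb := (CharP.cast_eq_zero_iff k p b).1 hb0
    obtain ⟨-, ⟨h1, -⟩ | ⟨-, -, hlt, hev⟩⟩ := h
    · have hpi : p ∣ i + 1 := by
        have : p ∣ 2 * (i + 1) := (Nat.dvd_add_right hpb).1 (hb ▸ h1)
        exact dvd_of_two_mul_natCast_eq_zero (k := k) hp (by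
          rw [← Nat.cast_ofNat, ← Nat.cast_mul]; exact (CharP.cast_eq_zero_iff k p _).2 this)
      have hle := Nat.le_of_dvd i.succ_pos hpi
      have hmod := Nat.mod_lt c₀ (show 0 < p by omega)
      have hdvd : p ∣ c₀ + (p - 1 - c₀ % p) + 1 := by
        have hd := Nat.div_add_mod c₀ p
        exact ⟨c₀ / p + 1, by rw [mul_add, mul_one]; omega⟩
      rcases (show p - 1 - c₀ % p ≤ i by omega).lt_or_eq with hl | hl
      · rw [chainWeight, Finset.prod_eq_zero (Finset.mem_range.2 hl), mul_zero]
        rw [(CharP.cast_eq_zero_iff k p _).2 hdvd, zero_div]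
      · rw [← hl, (CharP.cast_eq_zero_iff k p _).2 hdvd, zero_mul]
    · exfalso
      obtain ⟨m, rfl⟩ := hev
      have := Nat.le_of_dvd (by omega) hpb
      omega
  · field_simp

theorem IsSource.natCast_left_eq {n a₀ b₀ c₀ : ℕ} (h : IsSource p n a₀ b₀ c₀) :
    (a₀ : k) = c₀ := by
  obtain ⟨-, ⟨-, h⟩ | ⟨rfl, rfl, -⟩⟩ := h
  · exact (CharP.natCast_eq_natCast k p).2 h
  · rfl

/-- The single recursion behind the invariance of the functionals; here `b` is the exponent of `h`
of the monomial whose image under `e` is taken. -/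
theorem chainValue_relation (hp : 2 < p) {n a₀ b₀ c₀ : ℕ} (h : IsSource p n a₀ b₀ c₀) {b c : ℕ}
    (hb : b + 2 * (c + 1) = b₀ + 2 * c₀ + 1) :
    2 * (b : k) * chainValue k b₀ c₀ (c + 1) = ((c + 1 : ℕ) : k) * chainValue k b₀ c₀ c := by
  rcases lt_trichotomy (c + 1) c₀ with hc | hc | hc
  · rw [chainValue, chainValue, if_neg (by omega), if_neg (by omega), mul_zero, mul_zero]
  · have hb' : b = b₀ + 1 := by omega
    obtain ⟨-, ⟨h1, -⟩ | ⟨-, h0, -⟩⟩ := h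
    · rw [hb', (CharP.cast_eq_zero_iff k p _).2 h1, mul_zero, zero_mul,
        show chainValue k b₀ c₀ c = 0 from if_neg (by omega), mul_zero]
    · omega
  · obtain ⟨i, rfl⟩ := Nat.exists_eq_add_of_le (Nat.lt_succ_iff.1 hc)
    rw [chainValue, chainValue, if_pos (by omega), if_pos (by omega), Nat.add_sub_cancel_left,
      add_assoc c₀, Nat.add_sub_cancel_left]
    exact chainWeight_relation hp h (by omega)

/-- The functional kills the image of `e`. -/
theorem weight_slE (hp : 2 < p) {n a₀ b₀ c₀ : ℕ} (h : IsSource p n a₀ b₀ c₀) {a b c : ℕ}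
    (hn : a + b + c = n) :
    (c : k) * weight k n a₀ b₀ c₀ a (b + 1) (c - 1) -
      2 * (b : k) * weight k n a₀ b₀ c₀ (a + 1) (b - 1) c = 0 := by
  have hsum := h.1
  by_cases hch : a + 1 + c₀ = c + a₀
  · have h2 : 2 * (b : k) * weight k n a₀ b₀ c₀ (a + 1) (b - 1) c =
        2 * (b : k) * chainValue k b₀ c₀ c := by
      rcases b with _ | b
      · simp
      · rw [weight, if_pos ⟨hch, by omega⟩]
    rw [h2, sub_eq_zero]
    rcases c with _ | c
    · rw [Nat.cast_zero, zero_mul, eq_comm, chainValue]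
      split_ifs with hc
      · -- The chain starts at the edge `c = 0`, so that `b = b₀ + 1` vanishes.
        obtain ⟨-, ⟨h1, -⟩ | ⟨h0, -⟩⟩ := h
        · rw [show b = b₀ + 1 by omega, (CharP.cast_eq_zero_iff k p _).2 h1, mul_zero, zero_mul]
        · omega
      · rw [mul_zero]
    · rw [weight, Nat.add_sub_cancel, if_pos ⟨by omega, by omega⟩]
      exact (chainValue_relation hp h (by omega)).symm
  · rw [show weight k n a₀ b₀ c₀ (a + 1) (b - 1) c = 0 from if_neg fun h => hch h.1, mul_zero,
      sub_zero]
    rcases c with _ | c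
    · simp
    · rw [weight, if_neg (fun h => hch (by omega)), mul_zero]

/-- The functional kills the image of `f`. -/
theorem weight_slF (hp : 2 < p) {n a₀ b₀ c₀ : ℕ} (h : IsSource p n a₀ b₀ c₀) {a b c : ℕ}
    (hn : a + b + c = n) :
    2 * (b : k) * weight k n a₀ b₀ c₀ a (b - 1) (c + 1) -
      (a : k) * weight k n a₀ b₀ c₀ (a - 1) (b + 1) c = 0 := by
  have hsum := h.1
  by_cases hch : a + c₀ = c + 1 + a₀
  · have h2 : 2 * (b : k) * weight k n a₀ b₀ c₀ a (b - 1) (c + 1) =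
        2 * (b : k) * chainValue k b₀ c₀ (c + 1) := by
      rcases b with _ | b
      · simp
      · rw [weight, if_pos ⟨hch, by omega⟩]
    have hac : ((c + 1 : ℕ) : k) = a := by
      have h' : ((a + c₀ : ℕ) : k) = (c + 1 + a₀ : ℕ) := by rw [hch]
      rw [Nat.cast_add, Nat.cast_add, h.natCast_left_eq (k := k)] at h'
      exact (add_right_cancel h').symm
    rw [h2, chainValue_relation hp h (by omega), hac, ← mul_sub]
    rcases a with _ | a
    · simp
    · rw [weight, if_pos ⟨by omega, by omega⟩, sub_self, mul_zero]
  · rw [show weight k n a₀ b₀ c₀ a (b - 1) (c + 1) = 0 from if_neg fun h => hch h.1, mul_zero,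
      zero_sub, neg_eq_zero]
    rcases a with _ | a
    · simp
    · rw [weight, if_neg (fun h => hch (by omega)), mul_zero]

/-- The functional kills the image of `h`. -/
theorem weight_slH {n a₀ b₀ c₀ : ℕ} (h : IsSource p n a₀ b₀ c₀) (a b c : ℕ) :
    2 * ((a : k) - c) * weight k n a₀ b₀ c₀ a b c = 0 := by
  rw [weight]
  split_ifs with hch
  · have h' : ((a + c₀ : ℕ) : k) = (c + a₀ : ℕ) := by rw [hch.1]
    rw [Nat.cast_add, Nat.cast_add, h.natCast_left_eq (k := k)] at h'
    rw [add_right_cancel h', sub_self, mul_zero, zero_mul]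
  · rw [mul_zero]

theorem weight_eq_zero (hp : 2 < p) {n a₀ b₀ c₀ a b c : ℕ} (h₀ : IsSource p n a₀ b₀ c₀)
    (h : IsSource p n a b c) (hne : (a, b, c) ≠ (a₀, b₀, c₀)) :
    weight k n a₀ b₀ c₀ a b c = 0 := by
  rw [weight, chainValue]
  split_ifs with hch hc
  · have hs := h.1
    have hs₀ := h₀.1
    obtain ⟨i, rfl⟩ := Nat.exists_eq_add_of_le hc
    have hi : i ≠ 0 := by
      rintro rfl
      exact hne (by rw [show a = a₀ by omega, show b = b₀ by omega, add_zero])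
    obtain ⟨-, ⟨h1, -⟩ | ⟨-, hc0, -⟩⟩ := h
    · obtain ⟨-, ⟨h1₀, -⟩ | ⟨-, -, hlt, -⟩⟩ := h₀
      · -- The factor with index `p - 1` has a zero denominator.
        have hpi : p ∣ i := dvd_of_two_mul_natCast_eq_zero (k := k) hp (by
          rw [← Nat.cast_ofNat, ← Nat.cast_mul]
          refine (CharP.cast_eq_zero_iff k p _).2 ((Nat.dvd_add_right h1).1 ?_)
          rw [show b + 1 + 2 * i = b₀ + 1 by omega]
          exact h1₀)
        have hle := Nat.le_of_dvd (Nat.pos_of_ne_zero hi) hpi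
        rw [Nat.add_sub_cancel_left, chainWeight]
        refine Finset.prod_eq_zero (Finset.mem_range.2 (show p - 1 < i by omega)) ?_
        have hb₀ := (CharP.cast_eq_zero_iff k p _).2 h1₀
        rw [Nat.cast_succ] at hb₀
        rw [hb₀, Nat.sub_add_cancel (by omega), CharP.cast_eq_zero k p]
        simp
      · have := Nat.le_of_dvd b.succ_pos h1
        omega
    · omega
  · rfl
  · rfl

end Independence

/-! ### Counting the basis monomials, and the coinvariants of symmetric powers -/

section Count

theorem card_sigma_antidiagonal (K : ℕ) :
    ((Finset.range K).sigma fun m => Finset.HasAntidiagonal.antidiagonal m).card =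
      (K + 1).choose 2 := by
  rw [Finset.card_sigma]
  simp only [Finset.Nat.card_antidiagonal]
  induction K with
  | zero => rfl
  | succ K ih =>
    rw [Finset.sum_range_succ, ih, Nat.choose_succ_succ' (K + 1) 1, Nat.choose_one_right, add_comm]

/-- Writing `a = p * i + t`, `b + 1 = p * j`, `c = p * l + t` identifies the triples with
`p ∣ b + 1` and `a ≡ c` modulo `p` with the solutions of `i + j + l = K`, `j ≥ 1`. -/
theorem ncard_triples {p n K t : ℕ} (hp : Odd p) (ht : t < p) (hn : n + 1 = p * K + 2 * t) :
    {x : ℕ × ℕ × ℕ | x.1 + x.2.1 + x.2.2 = n ∧ p ∣ x.2.1 + 1 ∧ x.1 ≡ x.2.2 [MOD p]}.ncard =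
      (K + 1).choose 2 := by
  rw [← card_sigma_antidiagonal, ← Set.ncard_coe_finset]
  let F : (Σ _ : ℕ, ℕ × ℕ) → ℕ × ℕ × ℕ :=
    fun y => (p * y.2.1 + t, p * (K - y.1) - 1, p * y.2.2 + t)
  have hp0 : 0 < p := by omega
  rw [← Set.InjOn.ncard_image (f := F)]
  · congr 1
    ext ⟨a, b, c⟩
    simp only [Set.mem_ofPred_eq, Set.mem_image, Finset.coe_sigma, Set.mem_sigma_iff,
      Finset.mem_coe, Finset.mem_range, Finset.HasAntidiagonal.mem_antidiagonal, Sigma.exists,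
      Prod.exists, F,
      Prod.mk.injEq]
    constructor
    · rintro ⟨h1, ⟨j, hj⟩, h3⟩
      have ha := Nat.div_add_mod a p
      have hc := Nat.div_add_mod c p
      rw [← show a % p = c % p from h3] at hc
      have hs := Nat.mod_lt a hp0
      generalize a % p = s at ha hc hs
      generalize a / p = i at ha
      generalize c / p = l at hc
      have hsum : p * (i + l + j) + 2 * s = p * K + 2 * t := by
        rw [mul_add, mul_add]; omega
      have hst : s = t := by
        have h2 : 2 * s ≡ 2 * t [MOD p] := by
          have := congrArg (· % p) hsum
          simpa [Nat.ModEq, Nat.mul_add_mod] using this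
        exact Nat.ModEq.eq_of_lt_of_lt
          (Nat.ModEq.cancel_left_of_coprime (Nat.coprime_two_right.2 hp) h2) hs ht
      have hK : i + l + j = K := Nat.eq_of_mul_eq_mul_left hp0 (by omega)
      have hj0 : j ≠ 0 := by rintro rfl; omega
      refine ⟨i + l, i, l, ⟨by omega, rfl⟩, by omega, ?_, by omega⟩
      rw [show K - (i + l) = j by omega]
      omega
    · rintro ⟨m, i, l, ⟨hm, rfl⟩, rfl, rfl, rfl⟩
      obtain ⟨j, rfl⟩ := Nat.exists_eq_add_of_lt hm
      have hj : i + l + j + 1 - (i + l) = j + 1 := by omega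
      rw [hj]
      have hpos : 0 < p * (j + 1) := Nat.mul_pos hp0 j.succ_pos
      refine ⟨?_, ⟨j + 1, by omega⟩, ?_⟩
      · have : p * (i + l + j + 1) = p * i + p * l + p * (j + 1) := by ring
        omega
      · simp [Nat.ModEq]
  · rintro ⟨m, i, l⟩ h ⟨m', i', l'⟩ h' heq
    simp only [Finset.coe_sigma, Set.mem_sigma_iff, Finset.mem_coe,
      Finset.HasAntidiagonal.mem_antidiagonal] at h h'
    simp only [F, Prod.mk.injEq, add_left_inj, Nat.mul_right_inj hp0.ne'] at heq
    obtain ⟨rfl, -, rfl⟩ := heq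
    rw [← h.2, ← h'.2]

/-- The set of all triples `(a, b, c)` whose monomials form a basis of the coinvariants. -/
def sources (p n : ℕ) : Set (ℕ × ℕ × ℕ) := {x | IsSource p n x.1 x.2.1 x.2.2}

theorem finite_sources (p n : ℕ) : (sources p n).Finite := by
  refine Set.Finite.subset ((Set.finite_Iic n).prod ((Set.finite_Iic n).prod (Set.finite_Iic n))) ?_
  rintro ⟨a, b, c⟩ ⟨h, -⟩
  simp only [Set.mem_prod, Set.mem_Iic] at h ⊢
  omega

theorem ncard_sources {p n q r : ℕ} (hp : Odd p) (hp2 : 2 < p) (hn : n = q * p + r) (hr : r < p) :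
    (sources p n).ncard =
      if n ≤ p - 3 ∧ Even n then 1
      else if r = p - 1 then (q + 2).choose 2
      else if Odd r then (q + 1).choose 2
      else q.choose 2 := by
  by_cases h0 : n ≤ p - 3 ∧ Even n
  · rw [if_pos h0, Set.ncard_eq_one]
    refine ⟨(0, n, 0), ?_⟩
    ext ⟨a, b, c⟩
    simp only [sources, IsSource, Set.mem_ofPred_eq, Set.mem_singleton_iff, Prod.mk.injEq]
    constructor
    · rintro ⟨h1, ⟨h2, -⟩ | h2⟩
      · have := Nat.le_of_dvd b.succ_pos h2
        omega
      · omega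
    · rintro ⟨rfl, rfl, rfl⟩
      exact ⟨by omega, Or.inr ⟨rfl, rfl, by omega, h0.2⟩⟩
  · have hT : sources p n =
        {x : ℕ × ℕ × ℕ | x.1 + x.2.1 + x.2.2 = n ∧ p ∣ x.2.1 + 1 ∧ x.1 ≡ x.2.2 [MOD p]} := by
      ext ⟨a, b, c⟩
      simp only [sources, IsSource, Set.mem_ofPred_eq]
      refine and_congr_right fun h1 => or_iff_left ?_
      rintro ⟨rfl, rfl, h2, h3⟩
      simp only [zero_add, add_zero] at h1
      subst h1
      exact h0 ⟨by omega, h3⟩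
    obtain ⟨d, hd⟩ := hp
    rw [hT, if_neg h0]
    have hpq : q * p = p * q := mul_comm q p
    split_ifs with h1 h2
    · rw [ncard_triples ⟨d, hd⟩ (show 0 < p by omega) (K := q + 1)]
      rw [mul_add]; omega
    · obtain ⟨e, he⟩ := h2
      rw [ncard_triples ⟨d, hd⟩ (show e + 1 < p by omega) (K := q)]
      omega
    · obtain ⟨e, he⟩ := Nat.not_odd_iff_even.1 h2
      rcases q with _ | q
      · exact absurd ⟨by omega, e, by omega⟩ h0
      · rw [ncard_triples ⟨d, hd⟩ (show e + d + 1 < p by omega) (K := q)]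
        rw [mul_add] at hpq; omega

end Count

section Coinvariants

universe u

variable {k : Type u} [Field k] {p : ℕ} [CharP k p] {Q : Type u} [AddCommGroup Q] [Module k Q]
  {n : ℕ} {g : SymmetricAlgebra k (sl2 k) →ₗ[k] Q}

theorem symMono_mem_of_add_eq {a b c : ℕ} (h : a + b + c = n) :
    symMono k a b c ∈ SymPow k (sl2 k) n := h ▸ symMono_mem k a b c

/-- The relation between classes of monomials given by the action of `e`. -/
theorem coinvariant_relation_slE
    (hE : ∀ s ∈ SymPow k (sl2 k) n, g (adDer k (sl2 k) (slE k) s) = 0) {a b c : ℕ}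
    (h : a + b + c = n) : (c : k) • g (symMono k a (b + 1) (c - 1)) =
      (2 * b : k) • g (symMono k (a + 1) (b - 1) c) := by
  have := hE _ (symMono_mem_of_add_eq h)
  rwa [adDer_slE, map_sub, map_smul, map_smul, sub_eq_zero] at this

/-- In the coinvariants of degree `n ≥ p - 2`, the class of `h ^ n` vanishes unless `p ∣ n + 1`. -/
theorem coinvariant_slH_pow_eq_zero (hp : 2 < p) (hodd : Odd p)
    (hE : ∀ s ∈ SymPow k (sl2 k) n, g (adDer k (sl2 k) (slE k) s) = 0)
    (hn : ¬p ∣ n + 1) (h0 : ¬(n + 3 ≤ p ∧ Even n)) : g (symMono k 0 n 0) = 0 := by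
  have h2 := two_ne_zero_of_two_lt (k := k) p hp
  obtain ⟨d, hd⟩ := hodd
  -- `t` is the least positive solution of `2 * t = n + 1` modulo `p`.
  obtain ⟨t, ht0, htp, htn, m, hm⟩ : ∃ t, 0 < t ∧ t < p ∧ 2 * t ≤ n + 1 ∧ p ∣ n + 1 - 2 * t := by
    obtain ⟨N, hN⟩ : ∃ N, n + 1 = 2 * N ∨ n + 1 = 2 * N + p := by
      rcases Nat.even_or_odd n with ⟨e, he⟩ | ⟨e, he⟩
      · have : ¬ n + 3 ≤ p := fun h => h0 ⟨h, e, he⟩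
        have : n + 1 ≠ p := fun h => hn (h ▸ dvd_rfl)
        exact ⟨e - d, by omega⟩
      · exact ⟨e + 1, by omega⟩
    have hmod := Nat.div_add_mod N p
    have hlt := Nat.mod_lt N (show 0 < p by omega)
    refine ⟨N % p, Nat.pos_of_ne_zero fun h => hn ?_, hlt, by omega, ?_⟩
    · have hpN := Nat.dvd_of_mod_eq_zero h
      rcases hN with hN | hN
      · rw [hN]; exact hpN.mul_left 2
      · rw [hN]; exact (hpN.mul_left 2).add dvd_rfl
    · rcases hN with hN | hN
      · exact ⟨2 * (N / p), by rw [mul_left_comm]; omega⟩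
      · exact ⟨2 * (N / p) + 1, by rw [mul_add, mul_left_comm, mul_one]; omega⟩
  have hdown : ∀ i < t, g (symMono k (t - 1 - i) (n - 2 * (t - 1 - i)) (t - 1 - i)) = 0 := by
    intro i
    induction i with
    | zero =>
      intro _
      have h := coinvariant_relation_slE hE (a := t - 1) (b := n + 1 - 2 * t) (c := t) (by omega)
      rw [hm, Nat.cast_mul, CharP.cast_eq_zero k p, zero_mul, mul_zero, zero_smul, ← hm,
        show n + 1 - 2 * t + 1 = n - 2 * (t - 1) by omega] at h
      exact (smul_eq_zero.1 h).resolve_left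
        (natCast_ne_zero_of_not_dvd (p := p) fun hd => by have := Nat.le_of_dvd ht0 hd; omega)
    | succ i ih =>
      intro hi
      obtain ⟨c, hc⟩ : ∃ c, c = t - 1 - (i + 1) := ⟨_, rfl⟩
      have ih := ih (by omega)
      rw [show t - 1 - i = c + 1 by omega] at ih
      rw [← hc]
      have h := coinvariant_relation_slE hE (a := c) (b := n - 2 * c - 1) (c := c + 1) (by omega)
      rw [show n - 2 * c - 1 - 1 = n - 2 * (c + 1) by omega, ih, smul_zero,
        show n - 2 * c - 1 + 1 = n - 2 * c by omega, Nat.add_sub_cancel] at h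
      exact (smul_eq_zero.1 h).resolve_left
        (natCast_ne_zero_of_not_dvd (p := p) fun hd => by
          have := Nat.le_of_dvd c.succ_pos hd; omega)
  simpa using hdown (t - 1) (by omega)

/-- The classes of the source monomials span the coinvariants: any other monomial is either zero
or a multiple of the next monomial of its chain with smaller exponents of `e` and `f`. -/
theorem coinvariant_mem_of_sources_mem (hp : 2 < p) (hodd : Odd p)
    (hE : ∀ s ∈ SymPow k (sl2 k) n, g (adDer k (sl2 k) (slE k) s) = 0)
    (hH : ∀ s ∈ SymPow k (sl2 k) n, g (adDer k (sl2 k) (slH k) s) = 0)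
    (hF : ∀ s ∈ SymPow k (sl2 k) n, g (adDer k (sl2 k) (slF k) s) = 0)
    (W : Submodule k Q) (hW : ∀ x ∈ sources p n, g (symMono k x.1 x.2.1 x.2.2) ∈ W) (c : ℕ) :
    ∀ a b, a + b + c = n → g (symMono k a b c) ∈ W := by
  have h2 := two_ne_zero_of_two_lt (k := k) p hp
  have hdiv : ∀ b : ℕ, ¬p ∣ b + 1 → ∀ y : Q, (2 * (b + 1 : ℕ) : k) • y ∈ W → y ∈ W :=
    fun b hb y hy => (W.smul_mem_iff
      (mul_ne_zero h2 (natCast_ne_zero_of_not_dvd (p := p) hb))).1 hy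
  induction c with
  | zero =>
    intro a b h
    by_cases hb : p ∣ b + 1
    · by_cases ha : p ∣ a
      · exact hW (a, b, 0) ⟨h, Or.inl ⟨hb, (Nat.modEq_zero_iff_dvd).2 ha⟩⟩
      · have := hH _ (symMono_mem_of_add_eq h)
        rw [adDer_slH, map_smul, Nat.cast_zero, sub_zero] at this
        rw [(smul_eq_zero.1 this).resolve_left
          (mul_ne_zero h2 (natCast_ne_zero_of_not_dvd (p := p) ha))]
        exact W.zero_mem
    · rcases a with _ | a
      · rw [zero_add, add_zero] at h
        subst h
        by_cases h0 : b + 3 ≤ p ∧ Even b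
        · exact hW (0, b, 0) ⟨by simp, Or.inr ⟨rfl, rfl, h0.1, h0.2⟩⟩
        · rw [coinvariant_slH_pow_eq_zero hp hodd hE hb h0]
          exact W.zero_mem
      · have := coinvariant_relation_slE hE (a := a) (b := b + 1) (c := 0) (by omega)
        refine hdiv b hb _ ?_
        rw [Nat.add_sub_cancel] at this
        rw [← this, Nat.cast_zero, zero_smul]
        exact W.zero_mem
  | succ c ih =>
    intro a b h
    by_cases hb : p ∣ b + 1
    · by_cases ha : a ≡ c + 1 [MOD p]
      · exact hW (a, b, c + 1) ⟨h, Or.inl ⟨hb, ha⟩⟩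
      · have := hH _ (symMono_mem_of_add_eq h)
        rw [adDer_slH, map_smul] at this
        rw [(smul_eq_zero.1 this).resolve_left (mul_ne_zero h2 (sub_ne_zero.2
          fun h => ha ((CharP.natCast_eq_natCast k p).1 h)))]
        exact W.zero_mem
    · rcases a with _ | a
      · have := hF _ (symMono_mem_of_add_eq (a := 0) (b := b + 1) (c := c) (by omega))
        rw [adDer_slF, Nat.cast_zero, zero_smul, sub_zero, map_smul, Nat.add_sub_cancel] at this
        refine hdiv b hb _ ?_
        rw [this]
        exact W.zero_mem
      · have := coinvariant_relation_slE hE (a := a) (b := b + 1) (c := c + 1) (by omega)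
        refine hdiv b hb _ ?_
        rw [Nat.add_sub_cancel, Nat.add_sub_cancel] at this
        rw [← this]
        exact W.smul_mem _ (ih a (b + 1 + 1) (by omega))

/-- The invariant functional on `Sⁿ` attached to a source. -/
theorem exists_invariant_functional (hp : 2 < p) {x : ℕ × ℕ × ℕ} (hx : x ∈ sources p n) :
    ∃ φ : SymmetricAlgebra k (sl2 k) →ₗ[k] k,
      (∀ y ∈ sources p n, φ (symMono k y.1 y.2.1 y.2.2) = if y = x then 1 else 0) ∧
      ∀ s ∈ SymPow k (sl2 k) n, φ (adDer k (sl2 k) (slE k) s) = 0 ∧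
        φ (adDer k (sl2 k) (slH k) s) = 0 ∧ φ (adDer k (sl2 k) (slF k) s) = 0 := by
  obtain ⟨φ, hφ⟩ := exists_functional k (weight k n x.1 x.2.1 x.2.2)
  refine ⟨φ, fun y hy => ?_, fun s hs => ?_⟩
  · rw [hφ]
    split_ifs with h
    · rw [h, weight_self hx.1]
    · exact weight_eq_zero hp hx hy h
  · replace hs := symPow_le_span k n hs
    induction hs using Submodule.span_induction with
    | mem s h =>
      obtain ⟨a, b, c, habc, rfl⟩ := h
      rw [adDer_slE, adDer_slH, adDer_slF]
      simp only [map_sub, map_smul, hφ, smul_eq_mul]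
      exact ⟨weight_slE hp hx habc, weight_slH hx a b c, weight_slF hp hx habc⟩
    | zero => simp
    | add s t _ _ hs ht =>
      rw [map_add, map_add, map_add, map_add, map_add, map_add, hs.1, hs.2.1, hs.2.2, ht.1,
        ht.2.1, ht.2.2]
      simp
    | smul r s _ hs =>
      rw [Derivation.map_smul, Derivation.map_smul, Derivation.map_smul, map_smul, map_smul,
        map_smul, hs.1, hs.2.1, hs.2.2]
      simp

/-- The source monomials form a basis of the coinvariants of `Sⁿ`. -/
theorem finrank_coinvariants (hp : 2 < p) (hodd : Odd p)
    (hsurj : ∀ y, ∃ s ∈ SymPow k (sl2 k) n, g s = y)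
    (hker : ∀ s ∈ SymPow k (sl2 k) n, g s = 0 ↔ ∃ a ∈ SymPow k (sl2 k) n,
      ∃ b ∈ SymPow k (sl2 k) n, ∃ c ∈ SymPow k (sl2 k) n, s = adDer k (sl2 k) (slE k) a +
        adDer k (sl2 k) (slH k) b + adDer k (sl2 k) (slF k) c) :
    Module.Finite k Q ∧ Module.finrank k Q = (sources p n).ncard := by
  have hE : ∀ s ∈ SymPow k (sl2 k) n, g (adDer k (sl2 k) (slE k) s) = 0 := fun s hs =>
    (hker _ (adDer_mem k _ _ n s hs)).2 ⟨s, hs, 0, zero_mem _, 0, zero_mem _, by simp⟩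
  have hH : ∀ s ∈ SymPow k (sl2 k) n, g (adDer k (sl2 k) (slH k) s) = 0 := fun s hs =>
    (hker _ (adDer_mem k _ _ n s hs)).2 ⟨0, zero_mem _, s, hs, 0, zero_mem _, by simp⟩
  have hF : ∀ s ∈ SymPow k (sl2 k) n, g (adDer k (sl2 k) (slF k) s) = 0 := fun s hs =>
    (hker _ (adDer_mem k _ _ n s hs)).2 ⟨0, zero_mem _, 0, zero_mem _, s, hs, by simp⟩
  let v : sources p n → Q := fun x => g (symMono k x.1.1 x.1.2.1 x.1.2.2)
  have hspan : ⊤ ≤ Submodule.span k (Set.range v) := by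
    intro y _
    obtain ⟨s, hs, rfl⟩ := hsurj y
    have hle : SymPow k (sl2 k) n ≤ (Submodule.span k (Set.range v)).comap g := by
      refine (symPow_le_span k n).trans (Submodule.span_le.2 ?_)
      rintro _ ⟨a, b, c, habc, rfl⟩
      exact coinvariant_mem_of_sources_mem hp hodd hE hH hF _
        (fun x hx => Submodule.subset_span (Set.mem_range_self (f := v) ⟨x, hx⟩)) c a b habc
    exact hle hs
  have hli : LinearIndependent k v := by
    rw [linearIndependent_iff']
    intro t r hr x hx
    have hs : ∑ y ∈ t, r y • symMono k y.1.1 y.1.2.1 y.1.2.2 ∈ SymPow k (sl2 k) n :=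
      Submodule.sum_mem _ fun y _ => Submodule.smul_mem _ _ (symMono_mem_of_add_eq y.2.1)
    obtain ⟨a, ha, b, hb, c, hc, habc⟩ := (hker _ hs).1 (by simpa [v, map_sum] using hr)
    obtain ⟨φ, hφ, hinv⟩ := exists_invariant_functional (k := k) hp x.2
    have h := congrArg φ habc
    rw [map_add, map_add, (hinv a ha).1, (hinv b hb).2.1, (hinv c hc).2.2, map_sum] at h
    have h' : ∀ y ∈ t, φ (r y • symMono k y.1.1 y.1.2.1 y.1.2.2) = if y = x then r y else 0 := by
      intro y _
      rw [map_smul, hφ y.1 y.2, smul_eq_mul, mul_ite, mul_one, mul_zero]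
      exact if_congr Subtype.ext_iff.symm rfl rfl
    rw [Finset.sum_congr rfl h', Finset.sum_ite_eq' t x, if_pos hx] at h
    simpa using h
  let B := Module.Basis.mk hli hspan
  have : Finite (sources p n) := finite_sources p n
  exact ⟨Module.Finite.of_basis B, Module.finrank_eq_nat_card_basis B⟩

theorem finrank_ext_three_symModule (hp : 2 < p) (hodd : Odd p) (n : ℕ) :
    Module.Finite k (Abelian.Ext (trivialModule k) (symModule k n) 3) ∧
      Module.finrank k (Abelian.Ext (trivialModule k) (symModule k n) 3) =
        (sources p n).ncard := by
  obtain ⟨Φ, hΦ, hker⟩ := exists_surjective_ext_three_envModule (symRep k (sl2 k) n)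
  obtain ⟨g, hg⟩ := LinearMap.exists_extend Φ
  have hgΦ : ∀ s (hs : s ∈ SymPow k (sl2 k) n), g s = Φ ⟨s, hs⟩ :=
    fun s hs => LinearMap.congr_fun hg ⟨s, hs⟩
  have key := finrank_coinvariants (g := g) hp hodd
    (fun y => by
      obtain ⟨⟨s, hs⟩, rfl⟩ := hΦ y
      exact ⟨s, hs, hgΦ s hs⟩)
    (fun s hs => by
      rw [hgΦ s hs, hker]
      constructor
      · rintro ⟨a, b, c, h⟩
        exact ⟨a, a.2, b, b.2, c, c.2, congrArg Subtype.val h⟩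
      · rintro ⟨a, ha, b, hb, c, hc, h⟩
        exact ⟨⟨a, ha⟩, ⟨b, hb⟩, ⟨c, hc⟩, Subtype.ext h⟩)
  exact key

end Coinvariants

end SymLie

end

theorem mainTheorem6 {k : Type*} [Field k] (p : ℕ) [CharP k p] (hp : 2 < p)
    (n q r : ℕ) (hn : n = q * p + r) (hr : r < p) :
    Module.Finite k (Abelian.Ext (SymLie.trivialModule k) (SymLie.symModule k n) 3) ∧
    Module.finrank k (Abelian.Ext (SymLie.trivialModule k) (SymLie.symModule k n) 3) =
      if n ≤ p - 3 ∧ Even n then 1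
      else if r = p - 1 then (q + 2).choose 2
      else if Odd r then (q + 1).choose 2
      else q.choose 2 := by
  have hodd : Odd p := ((CharP.char_is_prime_or_zero k p).resolve_right (by omega)).odd_of_ne_two
    (by omega)
  rw [← SymLie.ncard_sources hodd hp hn hr]
  exact SymLie.finrank_ext_three_symModule hp hodd n
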